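/- All graphs are finite, simple and undirected. A graph is a \emph{path} if it is a tree of maximum degree at most two. For an integer $q \ge 1$, \textsc{$q$-Coloring on Path$+kv$ graphs} is the following parameterized problem: the input is a graph $G$ together with a set $X \subseteq V(G)$ such that $G - X$ is a path; the parameter is $k = |X|$; the question is whether the vertices of $G$ can be colored with $q$ colors so that adjacent vertices get different colors. For an integer $s$, \textsc{$s$-SAT} is the problem of deciding whether a Boolean formula in conjunctive normal form, all of whose clauses have size at most $s$, is satisfiable. A problem with parameter $k$ is solvable in time $\mathcal{O}^*(c^k)$ if there is a deterministic algorithm (a multi-stack, equivalently multi-tape, Turing machine) that answers correctly on every input of the problem within $c^k \cdot N^{\mathcal{O}(1)}$ steps, where $N$ is the length of the input. The Strong Exponential-Time Hypothesis (SETH) states that for every $\delta > 0$ there is a constant $s$ such that \textsc{$s$-SAT} on $n$ variables cannot be solved in time $\mathcal{O}^*((2-\delta)^n)$. \textbf{Corollary.} Assume SETH. Then for every real $\varepsilon > 0$ and every constant integer $q \ge 3$, \textsc{$q$-Coloring on Path$+kv$ graphs} cannot be solved in time $\mathcal{O}^*((q-\varepsilon)^k)$. -/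

import Mathlib

/-- `SolvableInOStarPow enc valid yes param c`: there is one deterministic multi-stack Turing
machine which, on every input `a` satisfying the promise `valid a`, given as the word `enc a`, halts
with the correct answer to the question "does `yes a` hold?", after at most `c ^ k * poly(N)` steps,
where `k = param a` is the parameter and `N` is the length of the input word. That is, the promise
problem is solvable in time `O*(c ^ k)`. Nothing is required on inputs violating the promise. -/
def SolvableInOStarPow {α : Type} (enc : α → List Computability.Γ') (valid yes : α → Prop)
    (param : α → ℕ) (c : ℝ) : Prop :=
  ∃ (M : Turing.TM2ComputableAux Computability.Γ' Bool) (p : Polynomial ℕ),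
    ∀ a : α, valid a → ∃ (t : ℕ) (answer : Bool),
      (t : ℝ) ≤ c ^ param a * (p.eval (enc a).length : ℕ) ∧
      (answer = true ↔ yes a) ∧
      Nonempty (Turing.TM2OutputsInTime M.tm
        ((enc a).map M.inputAlphabet.symm)
        (some ((Computability.encodeBool answer).map M.outputAlphabet.symm)) t)

/-- The natural number `i` in unary. -/
def unaryWord (i : ℕ) : List Computability.Γ' :=
  List.replicate i (Computability.Γ'.bit true)

/-! ### Satisfiability and the Strong Exponential-Time Hypothesis -/

/-- A Boolean formula in conjunctive normal form on the variables `0, …, numVars - 1`. A literal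
is a pair `(x, b)`; it is the variable `x` if `b = true`, and its negation if `b = false`. A clause
is a list of literals. -/
structure CNFFormula where
  numVars : ℕ
  clauses : List (List (Fin numVars × Bool))

namespace CNFFormula

/-- Some truth assignment makes at least one literal of every clause true. -/
def Satisfiable (φ : CNFFormula) : Prop :=
  ∃ v : Fin φ.numVars → Bool, ∀ C ∈ φ.clauses, ∃ l ∈ C, v l.1 = l.2

/-- Every clause has size at most `s`. -/
def HasWidthAtMost (s : ℕ) (φ : CNFFormula) : Prop :=
  ∀ C ∈ φ.clauses, C.length ≤ s

/-- A literal: a separator, its sign, and the index of its variable in unary. -/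
def encodeLiteral {n : ℕ} (l : Fin n × Bool) : List Computability.Γ' :=
  Computability.Γ'.comma :: Computability.Γ'.bit l.2 :: unaryWord l.1

/-- A clause: the sequence of its literals, between brackets. -/
def encodeClause {n : ℕ} (C : List (Fin n × Bool)) : List Computability.Γ' :=
  Computability.Γ'.bra :: (C.flatMap encodeLiteral ++ [Computability.Γ'.ket])

/-- A formula: the number of its variables in unary, followed by its clauses. As the number of
variables is itself present in unary, writing the indices in unary changes the length of the
input only polynomially. -/
def encode (φ : CNFFormula) : List Computability.Γ' :=
  unaryWord φ.numVars ++ φ.clauses.flatMap encodeClause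

end CNFFormula

/-- `s`-SAT on `n` variables is solvable in time `O*(c ^ n)`. -/
def SATSolvableInOStarPow (s : ℕ) (c : ℝ) : Prop :=
  SolvableInOStarPow CNFFormula.encode (CNFFormula.HasWidthAtMost s) CNFFormula.Satisfiable
    CNFFormula.numVars c

/-- The Strong Exponential-Time Hypothesis: for every `ε > 0` there is an `s` such that `s`-SAT on
`n` variables cannot be solved in time `O*((2 - ε) ^ n)`. -/
def SETH : Prop :=
  ∀ ε : ℝ, 0 < ε → ∃ s : ℕ, ¬ SATSolvableInOStarPow s (2 - ε)

/-! ### Coloring of graphs with a modulator to the class of paths -/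

/-- A finite simple graph on the vertices `0, …, numVertices - 1`, given by a list of its edges,
together with a set `X` of vertices (the modulator). -/
structure GraphWithModulator where
  numVertices : ℕ
  edges : List (Fin numVertices × Fin numVertices)
  loopless : ∀ e ∈ edges, e.1 ≠ e.2
  modulator : Finset (Fin numVertices)

namespace GraphWithModulator

/-- The undirected graph with the listed edges. -/
def graph (I : GraphWithModulator) : SimpleGraph (Fin I.numVertices) :=
  SimpleGraph.fromRel fun u v => (u, v) ∈ I.edges

/-- `G - X`: the subgraph induced by the vertices outside of the modulator. -/
def remainder (I : GraphWithModulator) : SimpleGraph ↥((I.modulator : Set (Fin I.numVertices))ᶜ) :=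
  I.graph.induce ((I.modulator : Set (Fin I.numVertices))ᶜ)

/-- An edge: its two endpoints in unary, between brackets and separated by a comma. -/
def encodeEdge {n : ℕ} (e : Fin n × Fin n) : List Computability.Γ' :=
  Computability.Γ'.bra ::
    (unaryWord e.1 ++ Computability.Γ'.comma :: (unaryWord e.2 ++ [Computability.Γ'.ket]))

/-- The graph and the modulator: one bit per vertex, which tells whether the vertex is in the
modulator, followed by the edges. As the word has a letter for each vertex, writing the endpoints
in unary changes the length of the input only polynomially. -/
def encode (I : GraphWithModulator) : List Computability.Γ' :=
  (List.ofFn fun v => Computability.Γ'.bit (decide (v ∈ I.modulator))) ++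
    I.edges.flatMap encodeEdge

end GraphWithModulator

/-- A graph is a path if it is a tree of maximum degree at most two. -/
def IsPathGraph {V : Type} (H : SimpleGraph V) : Prop :=
  H.IsTree ∧ ∀ v : V, (H.neighborSet v).encard ≤ 2

/-- `q`-Coloring on `Path + kv` graphs is solvable in time `O*(c ^ k)`: the input is a graph `G`
with a set `X` of `k` vertices such that `G - X` is a path, and the question is whether `G` has a
proper coloring with `q` colors. -/
def ColoringOnPathPlusKVSolvableInOStarPow (q : ℕ) (c : ℝ) : Prop :=
  SolvableInOStarPow GraphWithModulator.encode (fun I => IsPathGraph I.remainder)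
    (fun I => I.graph.Colorable q) (fun I => I.modulator.card) c

/-! ### Structured programs on stacks -/

/-! Suppose that coloring took time `(q - ε) ^ k`, and let `c = max (q - ε) 1 < q`. Cut the
variables of a formula into blocks of `b` and represent each block by a group of `p` modulator
vertices, whose `q ^ p` colorings are decoded by a surjection `D` onto the `2 ^ b` assignments of
the block. If `2 ^ b ≤ q ^ p` and still `c ^ p < 2 ^ b` (`exists_group_sizes`), then up to a
constant factor `n` variables cost `c ^ (p * n / b) = d ^ n` with `d < 2`, for every clause width
`s`. This contradicts SETH.

Another `q` modulator vertices form a clique, the palette. It names the colors, so that adjacency to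
the palette gives path vertices arbitrary color lists. A clause becomes a sequence of path segments,
one for each tuple `χ` of colorings of the groups of its at most `s` literals. The segment of `χ` is
uncolorable exactly if the groups are colored according to `χ` and `χ` falsifies every literal. It
is a row of four-vertex cells, one for each literal and each digit of its group, and it is entered
with the color `0` and closed by a vertex that must have the color `0`. So some cell has to turn the
signal `0` into another color, which a cell can do only if its attached modulator vertex does not
have the color predicted by `χ`; a nonzero signal can always be kept alive
(`exists_extends_cells_iff`). As every segment starts and ends with `0`, all segments fit on one
path and impose independent conditions (`extends_clauseLists_iff`, `satisfiable_iff`,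
`GraphWithModulator.colorable_iff`).

The reduction also has to run on a machine of the model. It is a structured stack program whose
output stack is the input stack of the coloring machine (`Exec.outputsInTime`). The data depending
on `q`, `p`, `b`, `s` and `D` are constants of the program, which otherwise only counts in unary and
divides by `b` (`run_mainProg`). -/

namespace StackProgram

/-- A configuration of a stack program: a variable, the working stacks, and the output stack. -/
structure State (K A σ : Type) where
  var : σ
  stk : K → List A
  out : List A

/-- The elementary operations of a stack program. The output stack is write-only. -/
inductive Op (K A σ : Type)
  | push (k : K) (f : σ → A)
  | pop (k : K) (f : σ → Option A → σ)
  | peek (k : K) (f : σ → Option A → σ)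
  | load (f : σ → σ)
  | emit (f : σ → A)

/-- Structured programs. -/
inductive Prog (K A σ : Type)
  | op (o : Op K A σ)
  | seq (P Q : Prog K A σ)
  | ite (c : σ → Bool) (P Q : Prog K A σ)
  | loop (c : σ → Bool) (P : Prog K A σ)

variable {K A σ : Type}

/-- The effect of an elementary operation. -/
def Op.run [DecidableEq K] : Op K A σ → State K A σ → State K A σ
  | push k f, s => { s with stk := Function.update s.stk k (f s.var :: s.stk k) }
  | pop k f, s => { s with
      var := f s.var (s.stk k).head?
      stk := Function.update s.stk k (s.stk k).tail }
  | peek k f, s => { s with var := f s.var (s.stk k).head? }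
  | load f, s => { s with var := f s.var }
  | emit f, s => { s with out := f s.var :: s.out }

/-- `Exec P s t s'`: started in `s`, the program `P` ends in `s'` after exactly `t` steps. -/
inductive Exec [DecidableEq K] : Prog K A σ → State K A σ → ℕ → State K A σ → Prop
  | op (o s) : Exec (.op o) s 1 (o.run s)
  | seq {P Q s t s' t' s''} : Exec P s t s' → Exec Q s' t' s'' → Exec (.seq P Q) s (t + t') s''
  | ite_true {c P Q s t s'} : c s.var = true → Exec P s t s' → Exec (.ite c P Q) s (1 + t) s'
  | ite_false {c P Q s t s'} : c s.var = false → Exec Q s t s' → Exec (.ite c P Q) s (1 + t) s'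
  | loop_false {c P s} : c s.var = false → Exec (.loop c P) s 1 s
  | loop_true {c P s t s' t' s''} : c s.var = true → Exec P s t s' →
      Exec (.loop c P) s' t' s'' → Exec (.loop c P) s (1 + t + t') s''

/-- The labels of the machine code of a program. -/
def Prog.Label : Prog K A σ → Type
  | .op _ => Unit
  | .seq P Q => P.Label ⊕ Q.Label
  | .ite _ P Q => Option (P.Label ⊕ Q.Label)
  | .loop _ P => Option P.Label

/-- The label at which a program starts. -/
def Prog.entry : (P : Prog K A σ) → P.Label
  | .op _ => ()
  | .seq P _ => Sum.inl P.entry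
  | .ite _ _ _ => none
  | .loop _ _ => none

/-- The labels of a program are finite in number. -/
@[reducible] noncomputable def Prog.labelFintype : (P : Prog K A σ) → Fintype P.Label
  | .op _ => inferInstanceAs (Fintype Unit)
  | .seq P Q =>
    letI := P.labelFintype
    letI := Q.labelFintype
    inferInstanceAs (Fintype (P.Label ⊕ Q.Label))
  | .ite _ P Q =>
    letI := P.labelFintype
    letI := Q.labelFintype
    inferInstanceAs (Fintype (Option (P.Label ⊕ Q.Label)))
  | .loop _ P =>
    letI := P.labelFintype
    inferInstanceAs (Fintype (Option P.Label))

open Turing Turing.TM2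

/-! ### Compilation of programs and composition with a machine. -/

section Compile

variable (tm : FinTM2) (sym : A → tm.Γ tm.k₀)

/-- The stack alphabets of the machine which first runs a program and then `tm`. -/
abbrev Alphabet (K A : Type) (tm : FinTM2) : K ⊕ tm.K → Type :=
  Sum.elim (fun _ => A) tm.Γ

/-- The stacks of the machine which first runs a program and then `tm`. -/
def joinStacks {tm : FinTM2} (S : K → List A) (T : ∀ k, List (tm.Γ k)) :
    ∀ k, List (Alphabet K A tm k)
  | Sum.inl k => S k
  | Sum.inr k => T k

theorem update_joinStacks_inl [DecidableEq K] (S : K → List A) (T : ∀ k, List (tm.Γ k)) (k : K)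
    (l : List A) :
    Function.update (joinStacks S T) (Sum.inl k) l = joinStacks (Function.update S k l) T := by
  funext j
  rcases j with j | j
  · by_cases h : j = k
    · subst h
      exact (Function.update_self ..).trans (Function.update_self (f := S) ..).symm
    · change _ = Function.update S k l j
      rw [Function.update_of_ne h]
      exact Function.update_of_ne (fun e => h (Sum.inl.inj e)) ..
  · exact Function.update_of_ne (fun e => by cases e) ..

theorem update_joinStacks_inr [DecidableEq K] (S : K → List A) (T : ∀ k, List (tm.Γ k)) (k : tm.K)
    (l : List (tm.Γ k)) :
    Function.update (joinStacks S T) (Sum.inr k) l = joinStacks S (Function.update T k l) := by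
  funext j
  rcases j with j | j
  · exact Function.update_of_ne (fun e => by cases e) ..
  · by_cases h : j = k
    · subst h
      exact (Function.update_self ..).trans (Function.update_self (f := T) ..).symm
    · change _ = Function.update T k l j
      rw [Function.update_of_ne h]
      exact Function.update_of_ne (fun e => h (Sum.inr.inj e)) ..

/-- The machine statement of an elementary operation, followed by the statement `q`. -/
def Op.stmt {Λ : Type} : Op K A σ → Stmt (Alphabet K A tm) Λ (σ × tm.σ) →
    Stmt (Alphabet K A tm) Λ (σ × tm.σ)
  | push k f, q => .push (Sum.inl k) (fun v => f v.1) q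
  | pop k f, q => .pop (Sum.inl k) (fun v a => (f v.1 a, v.2)) q
  | peek k f, q => .peek (Sum.inl k) (fun v a => (f v.1 a, v.2)) q
  | load f, q => .load (fun v => (f v.1, v.2)) q
  | emit f, q => .push (Sum.inr tm.k₀) (fun v => sym (f v.1)) q

/-- The machine code of a program, with a given embedding of the labels and a given exit label. -/
def Prog.code {Λ : Type} : (P : Prog K A σ) → (P.Label → Λ) → Λ → P.Label →
    Stmt (Alphabet K A tm) Λ (σ × tm.σ)
  | .op o, _, exit, _ => o.stmt tm sym (.goto fun _ => exit)
  | .seq P Q, emb, _, Sum.inl l => P.code (emb ∘ Sum.inl) (emb (Sum.inr Q.entry)) l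
  | .seq _ Q, emb, exit, Sum.inr l => Q.code (emb ∘ Sum.inr) exit l
  | .ite c P Q, emb, _, none => .branch (fun v => c v.1)
      (.goto fun _ => emb (some (Sum.inl P.entry))) (.goto fun _ => emb (some (Sum.inr Q.entry)))
  | .ite _ P _, emb, exit, some (Sum.inl l) => P.code (emb ∘ some ∘ Sum.inl) exit l
  | .ite _ _ Q, emb, exit, some (Sum.inr l) => Q.code (emb ∘ some ∘ Sum.inr) exit l
  | .loop c P, emb, exit, none => .branch (fun v => c v.1)
      (.goto fun _ => emb (some P.entry)) (.goto fun _ => exit)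
  | .loop _ P, emb, _, some l => P.code (emb ∘ some) (emb none) l

/-- The machine stacks which correspond to a state of a program. -/
def State.stacks (s : State K A σ) : ∀ k, List (Alphabet K A tm k) :=
  joinStacks s.stk (Function.update (fun _ => []) tm.k₀ (s.out.map sym))

/-- The machine configuration which corresponds to a state of a program. -/
def State.cfg {Λ : Type} (s : State K A σ) (l : Λ) : Cfg (Alphabet K A tm) Λ (σ × tm.σ) :=
  ⟨some l, (s.var, tm.initialState), s.stacks tm sym⟩

theorem Op.stepAux_stmt [DecidableEq K] {Λ : Type} (o : Op K A σ) (s : State K A σ) (exit : Λ) :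
    stepAux (o.stmt tm sym (.goto fun _ => exit)) (s.var, tm.initialState) (s.stacks tm sym) =
      (o.run s).cfg tm sym exit := by
  cases o with
  | push k f =>
    exact congrArg (Cfg.mk (some exit) (s.var, tm.initialState))
      (update_joinStacks_inl tm s.stk _ k (f s.var :: s.stk k))
  | pop k f =>
    exact congrArg (Cfg.mk (some exit) (f s.var (s.stk k).head?, tm.initialState))
      (update_joinStacks_inl tm s.stk _ k (s.stk k).tail)
  | peek k f => rfl
  | load f => rfl
  | emit f =>
    refine congrArg (Cfg.mk (some exit) (s.var, tm.initialState))
      ((update_joinStacks_inr tm s.stk _ tm.k₀ _).trans (congrArg (joinStacks s.stk) ?_))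
    have e : s.stacks tm sym (Sum.inr tm.k₀) = s.out.map sym :=
      Function.update_self (f := fun _ => []) ..
    rw [e]
    simp [Op.run]

/-- A run of a program is a run of its machine code. -/
theorem Exec.iterate_step [DecidableEq K] {Λ : Type}
    (m : Λ → Stmt (Alphabet K A tm) Λ (σ × tm.σ)) {P : Prog K A σ} {s s' : State K A σ} {t : ℕ}
    (h : Exec P s t s') : ∀ (emb : P.Label → Λ) (exit : Λ),
      (∀ l, m (emb l) = P.code tm sym emb exit l) →
      (flip bind (TM2.step m))^[t] (some (s.cfg tm sym (emb P.entry))) =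
        some (s'.cfg tm sym exit) := by
  induction h with
  | op o s =>
    intro emb exit hm
    have := hm ()
    simp only [Function.iterate_one, flip, Option.bind_eq_bind, Option.bind_some, State.cfg,
      TM2.step, Prog.entry, this, Prog.code]
    rw [Op.stepAux_stmt]
    rfl
  | @seq P Q s t s' t' s'' _ _ ih₁ ih₂ =>
    intro emb exit hm
    rw [add_comm, Function.iterate_add_apply]
    erw [ih₁ (emb ∘ Sum.inl) (emb (Sum.inr Q.entry)) fun l => hm (Sum.inl l)]
    exact ih₂ (emb ∘ Sum.inr) exit fun l => hm (Sum.inr l)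
  | @ite_true c P Q s t s' hc _ ih =>
    intro emb exit hm
    rw [add_comm, Function.iterate_add_apply]
    have := hm none
    have e : (flip bind (TM2.step m))^[1] (some (s.cfg tm sym (emb (Prog.ite c P Q).entry))) =
        some (s.cfg tm sym (emb (some (Sum.inl P.entry)))) := by
      simp [flip, State.cfg, Prog.entry, this, Prog.code, hc]
    rw [e]
    exact ih (emb ∘ some ∘ Sum.inl) exit fun l => hm (some (Sum.inl l))
  | @ite_false c P Q s t s' hc _ ih =>
    intro emb exit hm
    rw [add_comm, Function.iterate_add_apply]
    have := hm none
    have e : (flip bind (TM2.step m))^[1] (some (s.cfg tm sym (emb (Prog.ite c P Q).entry))) =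
        some (s.cfg tm sym (emb (some (Sum.inr Q.entry)))) := by
      simp [flip, State.cfg, Prog.entry, this, Prog.code, hc]
    rw [e]
    exact ih (emb ∘ some ∘ Sum.inr) exit fun l => hm (some (Sum.inr l))
  | @loop_false c P s hc =>
    intro emb exit hm
    have := hm none
    simp [flip, State.cfg, Prog.entry, this, Prog.code, hc]
  | @loop_true c P s t s' t' s'' hc _ _ ih₁ ih₂ =>
    intro emb exit hm
    have := hm none
    have e : (flip bind (TM2.step m))^[1] (some (s.cfg tm sym (emb (Prog.loop c P).entry))) =
        some (s.cfg tm sym (emb (some P.entry))) := by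
      simp [flip, State.cfg, Prog.entry, this, Prog.code, hc]
    rw [add_comm, Function.iterate_add_apply, add_comm, Function.iterate_add_apply, e]
    erw [ih₁ (emb ∘ some) (emb none) fun l => hm (some l)]
    exact ih₂ emb exit hm

/-- A statement of `tm`, as a statement of the machine which first runs a program. -/
def liftStmt {Λ : Type} (emb : tm.Λ → Λ) :
    Stmt tm.Γ tm.Λ tm.σ → Stmt (Alphabet K A tm) Λ (σ × tm.σ)
  | .push k f q => .push (Sum.inr k) (fun v => f v.2) (liftStmt emb q)
  | .pop k f q => .pop (Sum.inr k) (fun v a => (v.1, f v.2 a)) (liftStmt emb q)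
  | .peek k f q => .peek (Sum.inr k) (fun v a => (v.1, f v.2 a)) (liftStmt emb q)
  | .load f q => .load (fun v => (v.1, f v.2)) (liftStmt emb q)
  | .branch c q q' => .branch (fun v => c v.2) (liftStmt emb q) (liftStmt emb q')
  | .goto l => .goto fun v => emb (l v.2)
  | .halt => .halt

/-- A configuration of `tm`, as a configuration of the machine which first runs a program. -/
def liftCfg {Λ : Type} (emb : tm.Λ → Λ) (v₀ : σ) (S : K → List A)
    (c : Cfg tm.Γ tm.Λ tm.σ) : Cfg (Alphabet K A tm) Λ (σ × tm.σ) :=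
  ⟨c.l.map emb, (v₀, c.var), joinStacks S c.stk⟩

theorem stepAux_liftStmt [DecidableEq K] {Λ : Type} (emb : tm.Λ → Λ) (v₀ : σ) (S : K → List A)
    (q : Stmt tm.Γ tm.Λ tm.σ) (v : tm.σ) (T : ∀ k, List (tm.Γ k)) :
    stepAux (liftStmt tm emb q) (v₀, v) (joinStacks S T) =
      liftCfg tm emb v₀ S (stepAux q v T) := by
  induction q generalizing v T with
  | push k f q ih =>
    refine Eq.trans ?_ (ih v (Function.update T k (f v :: T k)))
    exact congrArg (stepAux _ _) (update_joinStacks_inr tm S T k _)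
  | pop k f q ih =>
    refine Eq.trans ?_ (ih (f v (T k).head?) (Function.update T k (T k).tail))
    exact congrArg (stepAux _ _) (update_joinStacks_inr tm S T k _)
  | peek k f q ih => exact ih (f v (T k).head?) T
  | load f q ih => simp [liftStmt, ih]
  | branch c q q' ih ih' => cases h : c v <;> simp [liftStmt, ih, ih', h]
  | goto l => simp [liftStmt, liftCfg]
  | halt => simp [liftStmt, liftCfg]

theorem step_liftCfg [DecidableEq K] {Λ : Type} (emb : tm.Λ → Λ) (v₀ : σ) (S : K → List A)
    (m : Λ → Stmt (Alphabet K A tm) Λ (σ × tm.σ)) (hm : ∀ l, m (emb l) = liftStmt tm emb (tm.m l))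
    (c : Cfg tm.Γ tm.Λ tm.σ) :
    TM2.step m (liftCfg tm emb v₀ S c) = (TM2.step tm.m c).map (liftCfg tm emb v₀ S) := by
  rcases c with ⟨_ | l, v, T⟩
  · simp [liftCfg]
  · simp only [liftCfg, Option.map_some, TM2.step, hm]
    rw [stepAux_liftStmt]
    rfl

/-- In the second phase the stacks `S` and the variable `v₀` of the finished program are never
touched, so lifting commutes with every step. -/
theorem iterate_step_liftCfg [DecidableEq K] {Λ : Type} (emb : tm.Λ → Λ) (v₀ : σ) (S : K → List A)
    (m : Λ → Stmt (Alphabet K A tm) Λ (σ × tm.σ)) (hm : ∀ l, m (emb l) = liftStmt tm emb (tm.m l))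
    (t : ℕ) (c : Option (Cfg tm.Γ tm.Λ tm.σ)) :
    (flip bind (TM2.step m))^[t] (c.map (liftCfg tm emb v₀ S)) =
      ((flip bind (TM2.step tm.m))^[t] c).map (liftCfg tm emb v₀ S) := by
  induction t generalizing c with
  | zero => rfl
  | succ t ih =>
    rw [Function.iterate_succ_apply, Function.iterate_succ_apply, ← ih]
    congr 1
    cases c with
    | none => rfl
    | some c => simp [flip, step_liftCfg tm emb v₀ S m hm]

/-- The machine which first runs the program `P`, starting with its input on the stack `k`, and then
runs `M` on the output of `P`. -/
noncomputable def Prog.machine [Fintype K] [DecidableEq K] [Fintype A] [Fintype σ]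
    (P : Prog K A σ) (k : K) (v₀ : σ) (M : TM2ComputableAux A Bool) : TM2ComputableAux A Bool where
  tm :=
    letI := P.labelFintype
    letI := M.tm.kFin
    letI := M.tm.ΛFin
    letI := M.tm.σFin
    { K := K ⊕ M.tm.K
      k₀ := Sum.inl k
      k₁ := Sum.inr M.tm.k₁
      Γ := Alphabet K A M.tm
      Λ := P.Label ⊕ M.tm.Λ
      main := Sum.inl P.entry
      σ := σ × M.tm.σ
      initialState := (v₀, M.tm.initialState)
      Γk₀Fin := inferInstanceAs (Fintype A)
      m := Sum.elim (P.code M.tm M.inputAlphabet.symm Sum.inl (Sum.inr M.tm.main))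
        fun l => liftStmt M.tm Sum.inr (M.tm.m l) }
  inputAlphabet := Equiv.refl A
  outputAlphabet := M.outputAlphabet

theorem initList_eq (tm : FinTM2) (w : List (tm.Γ tm.k₀)) :
    initList tm w = ⟨some tm.main, tm.initialState, Function.update (fun _ => []) tm.k₀ w⟩ := by
  refine congrArg (Cfg.mk (some tm.main) tm.initialState) ?_
  funext j
  by_cases h : j = tm.k₀
  · subst h; simp
  · simp [h]

theorem haltList_eq (tm : FinTM2) (w : List (tm.Γ tm.k₁)) :
    haltList tm w = ⟨none, tm.initialState, Function.update (fun _ => []) tm.k₁ w⟩ := by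
  refine congrArg (Cfg.mk none tm.initialState) ?_
  funext j
  by_cases h : j = tm.k₁
  · subst h; simp
  · simp [h]

theorem joinStacks_nil (tm : FinTM2) :
    joinStacks (fun _ : K => ([] : List A)) (fun k => ([] : List (tm.Γ k))) = fun _ => [] := by
  funext j
  rcases j with j | j <;> rfl

/-- The program writes onto the input stack of `M` and leaves the variable of `M` alone, so its
final state is an initial configuration of `M`. It must end with empty stacks and with `v₀`, because
`haltList` admits only the initial variable and a single nonempty stack. -/
theorem Exec.outputsInTime [Fintype K] [DecidableEq K] [Fintype A] [Fintype σ]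
    {P : Prog K A σ} {k : K} {v₀ : σ} {w w' : List A} {t t' : ℕ}
    (h : Exec P ⟨v₀, Function.update (fun _ => []) k w, []⟩ t ⟨v₀, fun _ => [], w'⟩)
    (M : TM2ComputableAux A Bool) {r : List Bool}
    (hM : Nonempty (TM2OutputsInTime M.tm (w'.map M.inputAlphabet.symm)
      (some (r.map M.outputAlphabet.symm)) t')) :
    Nonempty (TM2OutputsInTime (P.machine k v₀ M).tm
      (w.map (P.machine k v₀ M).inputAlphabet.symm)
      (some (r.map (P.machine k v₀ M).outputAlphabet.symm)) (t' + t)) := by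
  obtain ⟨⟨n, hn⟩, hle⟩ := hM
  refine ⟨⟨⟨n + t, ?_⟩, by simpa using hle⟩⟩
  rw [Function.iterate_add_apply]
  have h₁ := h.iterate_step M.tm M.inputAlphabet.symm (P.machine k v₀ M).tm.m Sum.inl
    (Sum.inr M.tm.main) fun _ => rfl
  have h₂ := iterate_step_liftCfg M.tm Sum.inr v₀ (fun _ : K => ([] : List A))
    (P.machine k v₀ M).tm.m (fun _ => rfl) n (some (initList M.tm (w'.map M.inputAlphabet.symm)))
  have e₁ : initList (P.machine k v₀ M).tm (w.map (P.machine k v₀ M).inputAlphabet.symm) =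
      State.cfg M.tm M.inputAlphabet.symm
        ⟨v₀, Function.update (fun _ => []) k w, []⟩ (Sum.inl P.entry) := by
    rw [initList_eq]
    refine congrArg (Cfg.mk _ _) ?_
    simp only [State.stacks, List.map_nil]
    rw [Function.update_eq_self M.tm.k₀ (fun _ => [])]
    rw [← update_joinStacks_inl, joinStacks_nil]
    exact congrArg _ (List.map_id w)
  have e₂ : State.cfg M.tm M.inputAlphabet.symm ⟨v₀, fun _ : K => [], w'⟩
      (Sum.inr M.tm.main : P.Label ⊕ M.tm.Λ) =
      liftCfg M.tm Sum.inr v₀ (fun _ => []) (initList M.tm (w'.map M.inputAlphabet.symm)) := by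
    rw [initList_eq]
    rfl
  have e₃ : haltList (P.machine k v₀ M).tm (r.map (P.machine k v₀ M).outputAlphabet.symm) =
      liftCfg M.tm Sum.inr v₀ (fun _ => []) (haltList M.tm (r.map M.outputAlphabet.symm)) := by
    rw [haltList_eq, haltList_eq]
    refine congrArg (Cfg.mk _ _) ?_
    rw [← update_joinStacks_inr, joinStacks_nil]
    rfl
  rw [e₁, Option.map_some, e₃]
  erw [h₁, e₂]
  exact h₂.trans (congrArg (Option.map _) hn)

end Compile

/-! ### Polynomial-time reductions. -/

theorem eval_mono (p : Polynomial ℕ) {m n : ℕ} (h : m ≤ n) : p.eval m ≤ p.eval n := by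
  rw [Polynomial.eval_eq_sum_range, Polynomial.eval_eq_sum_range]
  exact Finset.sum_le_sum fun i _ => Nat.mul_le_mul_left _ (Nat.pow_le_pow_left h i)

/-- A reduction which is computed by a stack program in polynomial time carries over algorithms. -/
theorem solvableInOStarPow_of_reduction [Fintype K] [DecidableEq K] [Fintype σ] {α β : Type}
    {encA : α → List Computability.Γ'} {validA yesA : α → Prop} {paramA : α → ℕ}
    {encB : β → List Computability.Γ'} {validB yesB : β → Prop} {paramB : β → ℕ} {c d : ℝ}
    (P : Prog K Computability.Γ' σ) (k : K) (v₀ : σ) (f : α → β) (R : Polynomial ℕ) (D : ℕ)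
    (hvalid : ∀ a, validA a → validB (f a)) (hyes : ∀ a, validA a → (yesB (f a) ↔ yesA a))
    (hrun : ∀ a, validA a → ∃ t ≤ R.eval (encA a).length,
      Exec P ⟨v₀, Function.update (fun _ => []) k (encA a), []⟩ t ⟨v₀, fun _ => [], encB (f a)⟩)
    (hlen : ∀ a, validA a → (encB (f a)).length ≤ R.eval (encA a).length)
    (hparam : ∀ a, validA a → c ^ paramB (f a) ≤ D * d ^ paramA a) (hd : 1 ≤ d)
    (h : SolvableInOStarPow encB validB yesB paramB c) :
    SolvableInOStarPow encA validA yesA paramA d := by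
  obtain ⟨M, p, hM⟩ := h
  -- The first summand pays for `M` on an instance of length at most `R`, with `D` absorbing the
  -- constant in the parameter bound. The second pays for the reduction itself, which is not
  -- exponential; this uses `1 ≤ d`.
  refine ⟨P.machine k v₀ M, Polynomial.C D * p.comp R + R, fun a ha => ?_⟩
  obtain ⟨t', r, ht', hr, hout⟩ := hM (f a) (hvalid a ha)
  obtain ⟨t, ht, hexec⟩ := hrun a ha
  refine ⟨t' + t, r, ?_, hr.trans (hyes a ha), hexec.outputsInTime M hout⟩
  have h₁ : p.eval (encB (f a)).length ≤ p.eval (R.eval (encA a).length) :=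
    eval_mono p (hlen a ha)
  have h₂ : (1 : ℝ) ≤ d ^ paramA a := one_le_pow₀ hd
  have h₃ : (t : ℝ) ≤ R.eval (encA a).length := by exact_mod_cast ht
  have h₄ : ((p.eval (encB (f a)).length : ℕ) : ℝ) ≤ (p.eval (R.eval (encA a).length) : ℕ) := by
    exact_mod_cast h₁
  simp only [Polynomial.eval_add, Polynomial.eval_mul, Polynomial.eval_C, Polynomial.eval_comp]
  push_cast
  rw [mul_add]
  refine add_le_add (ht'.trans ?_) (h₃.trans ?_)
  · calc c ^ paramB (f a) * ((p.eval (encB (f a)).length : ℕ) : ℝ)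
        ≤ (D * d ^ paramA a) * ((p.eval (R.eval (encA a).length) : ℕ) : ℝ) :=
          mul_le_mul (hparam a ha) h₄ (Nat.cast_nonneg _) (by positivity)
      _ = _ := by ring
  · exact le_mul_of_one_le_left (Nat.cast_nonneg _) h₂

end StackProgram

/-! ### Graphs which consist of a modulator and a path -/

/-- The vertices of a path, in their order, have the lists `Ns` of neighbours outside of the path.
`Extends col q c Ns c'` states that a coloring `col` of the other vertices can be extended to the
path with the colors `0, …, q - 1` such that the first vertex of the path does not have the color
`c` and the last one has the color `c'`. -/
def Extends (col : ℕ → ℕ) (q : ℕ) : ℕ → List (List ℕ) → ℕ → Prop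
  | c, [], c' => c = c'
  | c, N :: Ns, c' => ∃ d < q, d ≠ c ∧ (∀ m ∈ N, col m ≠ d) ∧ Extends col q d Ns c'

namespace Extends

variable {col : ℕ → ℕ} {q : ℕ}

theorem append_iff {Ns Ns' : List (List ℕ)} {c c' : ℕ} :
    Extends col q c (Ns ++ Ns') c' ↔ ∃ d, Extends col q c Ns d ∧ Extends col q d Ns' c' := by
  induction Ns generalizing c with
  | nil => simp [Extends]
  | cons N Ns ih =>
    simp only [List.cons_append, Extends, ih]
    constructor
    · rintro ⟨d, h₁, h₂, h₃, e, h₄, h₅⟩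
      exact ⟨e, ⟨d, h₁, h₂, h₃, h₄⟩, h₅⟩
    · rintro ⟨e, ⟨d, h₁, h₂, h₃, h₄⟩, h₅⟩
      exact ⟨d, h₁, h₂, h₃, e, h₄, h₅⟩

/-- The indices are shifted by one: `h 0` is the color before the path, and `h (j + 1)` is the color
of its `j`-th vertex. -/
theorem of_fun (Ns : List (List ℕ)) (h : ℕ → ℕ)
    (H : ∀ j N, Ns[j]? = some N → h (j + 1) < q ∧ h (j + 1) ≠ h j ∧ ∀ m ∈ N, col m ≠ h (j + 1)) :
    Extends col q (h 0) Ns (h Ns.length) := by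
  induction Ns generalizing h with
  | nil => rfl
  | cons N Ns ih =>
    obtain ⟨h₁, h₂, h₃⟩ := H 0 N rfl
    exact ⟨h 1, h₁, h₂, h₃, ih (fun j => h (j + 1)) fun j N' hj => H (j + 1) N' (by simpa using hj)⟩

theorem exists_fun {Ns : List (List ℕ)} {c c' : ℕ} (h : Extends col q c Ns c') :
    ∃ f : ℕ → ℕ, f 0 = c ∧ ∀ j N, Ns[j]? = some N →
      f (j + 1) < q ∧ f (j + 1) ≠ f j ∧ ∀ m ∈ N, col m ≠ f (j + 1) := by
  induction Ns generalizing c with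
  | nil => exact ⟨fun _ => c, rfl, by simp⟩
  | cons N Ns ih =>
    obtain ⟨d, h₁, h₂, h₃, h₄⟩ := h
    obtain ⟨f, hf, H⟩ := ih h₄
    refine ⟨fun j => Nat.casesOn j c f, rfl, fun j N' hj => ?_⟩
    cases j with
    | zero =>
      obtain rfl : N = N' := by simpa using hj
      simpa [hf] using ⟨h₁, h₂, h₃⟩
    | succ j => exact H j N' (by simpa using hj)

end Extends

/-- Every edge is a bridge: without the edge from `v` to its successor, no walk leaves the initial
segment that ends in `v`. -/
theorem pathGraph_isTree (n : ℕ) : (SimpleGraph.pathGraph (n + 1)).IsTree := by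
  refine ⟨SimpleGraph.pathGraph_connected n, ?_⟩
  have key : ∀ v w : Fin (n + 1), v.1 + 1 = w.1 →
      ¬ ((SimpleGraph.pathGraph (n + 1)).deleteEdges {s(v, w)}).Reachable v w := by
    rintro v w hvw ⟨W⟩
    have : ∀ x y : Fin (n + 1),
        ((SimpleGraph.pathGraph (n + 1)).deleteEdges {s(v, w)}).Walk x y → x ≤ v → y ≤ v := by
      intro x y W
      induction W with
      | nil => exact id
      | cons h _ ih =>
        intro hx
        refine ih ?_
        rw [SimpleGraph.deleteEdges_adj, SimpleGraph.pathGraph_adj] at h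
        obtain ⟨h₁, h₂⟩ := h
        by_contra hlt
        apply h₂
        rw [Set.mem_singleton_iff, Sym2.eq_iff]
        left
        constructor <;> ext <;> simp only [Fin.le_def] at * <;> omega
    have := this v w W le_rfl
    rw [Fin.le_def] at this
    omega
  rw [SimpleGraph.isAcyclic_iff_forall_adj_isBridge]
  intro v w hvw
  rw [SimpleGraph.isBridge_iff]
  rw [SimpleGraph.pathGraph_adj] at hvw
  rcases hvw with h | h
  · exact key v w h
  · intro h'
    rw [Sym2.eq_swap] at h'
    exact key w v h h'.symm

namespace GraphWithModulator

/-- The edge relation on natural numbers of a graph with a modulator `0, …, m - 1`, which contains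
the clique `0, …, q - 1`, and a path `m, m + 1, …`, whose vertices have the lists `spec` of
neighbours in the modulator. -/
def PathRel (q m : ℕ) (spec : List (List ℕ)) (u v : ℕ) : Prop :=
  (u < v ∧ v < q) ∨ (m ≤ u ∧ v = u + 1) ∨ ∃ N, m ≤ u ∧ spec[u - m]? = some N ∧ v ∈ N

variable {I : GraphWithModulator} {q m : ℕ} {spec : List (List ℕ)}

/-- Palette edges and list edges have an endpoint below `m`, so outside of the modulator only the
edges between consecutive vertices survive. -/
theorem isPathGraph_remainder (hn : I.numVertices = m + spec.length)
    (hmod : ∀ v, v ∈ I.modulator ↔ v.1 < m)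
    (hedges : ∀ u v, (u, v) ∈ I.edges ↔ PathRel q m spec u.1 v.1)
    (hq : q ≤ m) (hspec : spec ≠ []) (hlt : ∀ N ∈ spec, ∀ x ∈ N, x < m) :
    IsPathGraph I.remainder := by
  obtain ⟨L, hL⟩ : ∃ L, spec.length = L + 1 :=
    Nat.exists_eq_succ_of_ne_zero (by simpa using hspec)
  have hge : ∀ x : ↥((I.modulator : Set (Fin I.numVertices))ᶜ), m ≤ x.1.1 := by
    intro x
    have := x.2
    simp only [Set.mem_compl_iff, Finset.mem_coe, hmod] at this
    omega
  have hrel : ∀ u v : Fin I.numVertices, m ≤ u.1 → m ≤ v.1 →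
      ((u, v) ∈ I.edges ↔ v.1 = u.1 + 1) := by
    intro u v hu hv
    rw [hedges, PathRel]
    constructor
    · rintro (h | h | ⟨N, _, h, hv'⟩)
      · omega
      · exact h.2
      · have := hlt N (List.mem_of_getElem? h) _ hv'
        omega
    · exact fun h => Or.inr (Or.inl ⟨hu, h⟩)
  let e : SimpleGraph.pathGraph (L + 1) ≃g I.remainder :=
    { toFun := fun j => ⟨⟨m + j.1, by omega⟩, by simp [hmod]⟩
      invFun := fun x => ⟨x.1.1 - m, by have := x.1.2; omega⟩
      left_inv := fun j => by simp
      right_inv := fun x => by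
        have := hge x
        ext
        simp only
        omega
      map_rel_iff' := by
        intro a b
        simp only [remainder, graph, SimpleGraph.comap_adj, SimpleGraph.fromRel_adj,
          SimpleGraph.pathGraph_adj, Equiv.coe_fn_mk, Function.Embedding.subtype_apply, ne_eq,
          Fin.mk.injEq]
        rw [hrel _ _ (by simp) (by simp), hrel _ _ (by simp) (by simp)]
        simp only
        omega }
  refine ⟨e.isTree_iff.1 (pathGraph_isTree L), fun v => ?_⟩
  obtain ⟨j, rfl⟩ := e.surjective v
  have hsub : I.remainder.neighborSet (e j) ⊆
      {x | x.1.1 = m + j.1 + 1} ∪ {x | x.1.1 + 1 = m + j.1} := by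
    intro x hx
    obtain ⟨i, rfl⟩ := e.surjective x
    rw [SimpleGraph.mem_neighborSet, e.map_adj_iff, SimpleGraph.pathGraph_adj] at hx
    change (m + i.1 = m + j.1 + 1) ∨ (m + i.1 + 1 = m + j.1)
    omega
  have hone : ∀ k, ({x | x.1.1 = k} :
      Set ↥((I.modulator : Set (Fin I.numVertices))ᶜ)).encard ≤ 1 := by
    intro k
    rw [Set.encard_le_one_iff]
    intro a b ha hb
    ext
    exact Eq.trans ha (Eq.symm hb)
  have hone' : ∀ k, ({x | x.1.1 + 1 = k} :
      Set ↥((I.modulator : Set (Fin I.numVertices))ᶜ)).encard ≤ 1 := by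
    intro k
    rw [Set.encard_le_one_iff]
    intro a b ha hb
    ext
    have : a.1.1 + 1 = b.1.1 + 1 := Eq.trans ha (Eq.symm hb)
    omega
  calc _ ≤ _ := Set.encard_le_encard hsub
    _ ≤ _ := Set.encard_union_le _ _
    _ ≤ 1 + 1 := add_le_add (hone _) (hone' _)
    _ = 2 := by norm_num

/-- A proper coloring uses all `q` colors on the clique, so after permuting the colors the palette
vertex `x` has the color `x`. What remains is a list coloring along the path. The entry value `q` is
not a color and does not constrain the first vertex. -/
theorem colorable_iff (hn : I.numVertices = m + spec.length)
    (hedges : ∀ u v, (u, v) ∈ I.edges ↔ PathRel q m spec u.1 v.1)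
    (hq : q ≤ m) (hlt : ∀ N ∈ spec, ∀ x ∈ N, x < m) (hpos : 0 < q) :
    I.graph.Colorable q ↔ ∃ col : ℕ → ℕ, (∀ x, col x < q) ∧ (∀ x < q, col x = x) ∧
      ∃ c, Extends col q q spec c := by
  have hadj : ∀ u v : Fin I.numVertices, PathRel q m spec u.1 v.1 → u ≠ v → I.graph.Adj u v := by
    intro u v h hne
    rw [graph, SimpleGraph.fromRel_adj]
    exact ⟨hne, Or.inl ((hedges u v).2 h)⟩
  constructor
  · rintro ⟨f⟩
    have hf : ∀ u v : Fin I.numVertices, PathRel q m spec u.1 v.1 → u.1 ≠ v.1 → f u ≠ f v :=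
      fun u v h hne => f.valid (hadj u v h fun e => hne (congrArg _ e))
    let g : Fin q → Fin q := fun c => f ⟨c.1, by omega⟩
    have hg : Function.Injective g := by
      intro c c' h
      by_contra hne
      have hne' : c.1 ≠ c'.1 := fun e => hne (Fin.ext e)
      rcases lt_or_gt_of_ne hne' with hlt | hlt
      · exact hf ⟨c.1, by omega⟩ ⟨c'.1, by omega⟩ (Or.inl ⟨hlt, c'.2⟩) hne' h
      · exact hf ⟨c'.1, by omega⟩ ⟨c.1, by omega⟩ (Or.inl ⟨hlt, c.2⟩) hne'.symm h.symm
    let e : Fin q ≃ Fin q := Equiv.ofBijective g (Finite.injective_iff_bijective.1 hg)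
    let col : ℕ → ℕ := fun x => if h : x < I.numVertices then (e.symm (f ⟨x, h⟩)).1 else 0
    have hcol : ∀ u : Fin I.numVertices, col u.1 = (e.symm (f u)).1 := fun u => dif_pos u.2
    have hne : ∀ u v : Fin I.numVertices, PathRel q m spec u.1 v.1 → u.1 ≠ v.1 →
        col u.1 ≠ col v.1 := by
      intro u v h hne h'
      rw [hcol, hcol] at h'
      exact hf u v h hne (e.symm.injective (Fin.ext h'))
    have hcollt : ∀ x, col x < q := by
      intro x
      by_cases h : x < I.numVertices
      · rw [hcol ⟨x, h⟩]; exact Fin.is_lt _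
      · simpa [col, h] using hpos
    refine ⟨col, hcollt, ?_, ?_⟩
    · intro x hx
      rw [hcol ⟨x, by omega⟩]
      have : e ⟨x, hx⟩ = f ⟨x, by omega⟩ := rfl
      rw [← this, Equiv.symm_apply_apply]
    -- The value at `0` is the fictitious color `q` in front of the path.
    · let h : ℕ → ℕ := fun j => Nat.casesOn j q fun j => col (m + j)
      refine ⟨_, Extends.of_fun spec h fun j N hj => ⟨hcollt _, ?_, fun x hx => ?_⟩⟩
      · have hjL := (List.getElem?_eq_some_iff.1 hj).1
        cases j with
        | zero => exact (hcollt _).ne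
        | succ j =>
          exact (hne ⟨m + j, by omega⟩ ⟨m + (j + 1), by omega⟩
            (Or.inr (Or.inl ⟨by simp, by simp [add_assoc]⟩)) (by simp)).symm
      · have hjL := (List.getElem?_eq_some_iff.1 hj).1
        have hxm := hlt N (List.mem_of_getElem? hj) x hx
        exact (hne ⟨m + j, by omega⟩ ⟨x, by omega⟩
          (Or.inr (Or.inr ⟨N, by simp, by simpa using hj, hx⟩)) (by simp; omega)).symm
  · rintro ⟨col, hcollt, hcol, c, hc⟩
    obtain ⟨h, h0, H⟩ := hc.exists_fun
    have hh : ∀ j < spec.length, h (j + 1) < q := fun j hj =>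
      (H j _ (List.getElem?_eq_getElem hj)).1
    let F : Fin I.numVertices → ℕ := fun x => if x.1 < m then col x.1 else h (x.1 - m + 1)
    have hF : ∀ x, F x < q := by
      intro x
      by_cases hx : x.1 < m
      · simpa [F, hx] using hcollt _
      · simpa [F, hx] using hh _ (by have := x.2; omega)
    have hrel : ∀ u v : Fin I.numVertices, PathRel q m spec u.1 v.1 → F u ≠ F v := by
      rintro u v (⟨huv, hv⟩ | ⟨hu, hv⟩ | ⟨N, hu, hN, hv⟩)
      · have h₁ : u.1 < m := by omega
        have h₂ : v.1 < m := by omega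
        simp only [F, h₁, h₂, if_true, hcol _ hv, hcol _ (huv.trans hv)]
        omega
      · have h₁ : ¬ u.1 < m := by omega
        have h₂ : ¬ v.1 < m := by omega
        simp only [F, h₁, h₂, if_false]
        have hvn := v.2
        have := (H (v.1 - m) _ (List.getElem?_eq_getElem (by omega))).2.1
        rw [show v.1 - m = u.1 - m + 1 by omega] at this ⊢
        exact this.symm
      · have h₁ : ¬ u.1 < m := by omega
        have h₂ : v.1 < m := hlt N (List.mem_of_getElem? hN) _ hv
        simp only [F, h₁, h₂, if_false, if_true]
        exact ((H _ N hN).2.2 _ hv).symm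
    refine ⟨SimpleGraph.Coloring.mk (fun x => ⟨F x, hF x⟩) ?_⟩
    intro u v huv heq
    rw [graph, SimpleGraph.fromRel_adj, hedges, hedges] at huv
    have heq' : F u = F v := congrArg Fin.val heq
    rcases huv.2 with h' | h'
    · exact hrel u v h' heq'
    · exact hrel v u h' heq'.symm

end GraphWithModulator

/-! ### The clause gadget -/

namespace ClauseGadget

/-- The colors outside of `S`. -/
def others (q : ℕ) (S : List ℕ) : List ℕ :=
  (List.range q).filter (· ∉ S)

/-- As the palette vertex `x` has the color `x`, being joined to the palette outside of `S` amounts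
to having the color list `S`. -/
theorem forall_others_append_iff {q : ℕ} {S E : List ℕ} {col : ℕ → ℕ} (hcol : ∀ x < q, col x = x)
    {d : ℕ} (hd : d < q) :
    (∀ m ∈ others q S ++ E, col m ≠ d) ↔ d ∈ S ∧ ∀ m ∈ E, col m ≠ d := by
  simp only [List.mem_append, or_imp, forall_and]
  refine and_congr_left fun _ => ⟨fun h => ?_, fun h m hm => ?_⟩
  · by_contra hS
    exact h d (by simp [others, hd, hS]) (hcol d hd)
  · simp only [others, List.mem_filter, List.mem_range, decide_eq_true_eq] at hm
    rw [hcol m hm.1]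
    rintro rfl
    exact hm.2 h

/-- A color other than `0` and `γ`. -/
def colorA (γ : ℕ) : ℕ := if γ = 1 then 2 else 1

/-- A color other than `colorA γ` and `γ`. -/
def colorB (γ : ℕ) : ℕ := if γ = 0 then 2 else 0

/-- A cell of four path vertices, which are adjacent to the vertices of the palette outside of the
respective lists, and the third of which is also adjacent to the vertices in `E`. -/
def cellLists (q γ : ℕ) (E : List ℕ) : List (List ℕ) :=
  [others q [0, colorA γ], others q [colorA γ, colorB γ],
    others q [colorA γ, colorB γ, γ] ++ E, others q [colorA γ, 0]]

section Cell

variable {q γ : ℕ} {E : List ℕ} {col : ℕ → ℕ}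

theorem extends_cellLists_iff (hcol : ∀ x < q, col x = x) (c c' : ℕ) :
    Extends col q c (cellLists q γ E) c' ↔
      ∃ d₁ < q, d₁ ≠ c ∧ d₁ ∈ [0, colorA γ] ∧ ∃ d₂ < q, d₂ ≠ d₁ ∧ d₂ ∈ [colorA γ, colorB γ] ∧
        ∃ d₃ < q, d₃ ≠ d₂ ∧ (d₃ ∈ [colorA γ, colorB γ, γ] ∧ ∀ m ∈ E, col m ≠ d₃) ∧
          c' < q ∧ c' ≠ d₃ ∧ c' ∈ [colorA γ, 0] := by
  have key : ∀ S : List ℕ, ∀ d < q, (∀ m ∈ others q S, col m ≠ d) ↔ d ∈ S := by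
    intro S d hd
    simpa using forall_others_append_iff (S := S) (E := []) hcol hd
  simp only [cellLists, Extends]
  constructor
  · rintro ⟨d₁, h₁, n₁, a₁, d₂, h₂, n₂, a₂, d₃, h₃, n₃, a₃, d₄, h₄, n₄, a₄, rfl⟩
    exact ⟨d₁, h₁, n₁, (key _ _ h₁).1 a₁, d₂, h₂, n₂, (key _ _ h₂).1 a₂, d₃, h₃, n₃,
      (forall_others_append_iff hcol h₃).1 a₃, h₄, n₄, (key _ _ h₄).1 a₄⟩
  · rintro ⟨d₁, h₁, n₁, a₁, d₂, h₂, n₂, a₂, d₃, h₃, n₃, a₃, h₄, n₄, a₄⟩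
    exact ⟨d₁, h₁, n₁, (key _ _ h₁).2 a₁, d₂, h₂, n₂, (key _ _ h₂).2 a₂, d₃, h₃, n₃,
      (forall_others_append_iff hcol h₃).2 a₃, c', h₄, n₄, (key _ _ h₄).2 a₄, rfl⟩

theorem colorA_ne_zero : colorA γ ≠ 0 := by unfold colorA; split <;> omega

theorem colorA_ne : colorA γ ≠ γ := by unfold colorA; split <;> omega

theorem colorB_ne : colorB γ ≠ γ := by unfold colorB; split <;> omega

theorem colorA_ne_colorB : colorA γ ≠ colorB γ := by
  unfold colorA colorB; split <;> split <;> omega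

theorem colorA_lt (hq : 3 ≤ q) : colorA γ < q := by unfold colorA; split <;> omega

theorem colorB_lt (hq : 3 ≤ q) : colorB γ < q := by unfold colorB; split <;> omega

/-- A blocked cell passes on the color `0`. -/
theorem eq_zero_of_extends_cellLists (hcol : ∀ x < q, col x = x)
    (hE : ∃ m ∈ E, col m = γ) {c' : ℕ} (h : Extends col q 0 (cellLists q γ E) c') : c' = 0 := by
  rw [extends_cellLists_iff hcol] at h
  obtain ⟨d₁, h₁, n₁, a₁, d₂, h₂, n₂, a₂, d₃, h₃, n₃, ⟨a₃, e₃⟩, h₄, n₄, a₄⟩ := h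
  obtain ⟨m, hm, hγ⟩ := hE
  -- Entered with `0`, the four vertices are forced to `colorA γ`, `colorB γ`, `colorA γ`, `0`,
  -- since the attached vertex bars `γ` from the third.
  have := e₃ m hm
  simp only [List.mem_cons, List.not_mem_nil, or_false] at a₁ a₂ a₃ a₄
  omega

/-- A cell which is not blocked, or which is not entered with the color `0`, can pass on another
color than `0`. -/
theorem exists_extends_cellLists (hq : 3 ≤ q) (hγ : γ < q) (hcol : ∀ x < q, col x = x)
    (hE : E.length ≤ 1) (c : ℕ) (h : c ≠ 0 ∨ ∀ m ∈ E, col m ≠ γ) :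
    ∃ c' ≠ 0, Extends col q c (cellLists q γ E) c' := by
  have hA : colorA γ < q := colorA_lt hq
  have hB : colorB γ < q := colorB_lt hq
  refine ⟨colorA γ, colorA_ne_zero, (extends_cellLists_iff hcol _ _).2 ?_⟩
  have h₁ := colorA_ne_zero (γ := γ)
  have h₂ := colorA_ne (γ := γ)
  have h₃ := colorB_ne (γ := γ)
  have h₄ := colorA_ne_colorB (γ := γ)
  by_cases hc : c = 0
  · subst hc
    have hγE := h.resolve_left (by simp)
    -- With `γ` available for the third vertex, the colors `colorA γ`, `colorB γ`, `γ`, `colorA γ`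
    -- switch the signal.
    exact ⟨colorA γ, hA, h₁, by simp, colorB γ, hB, h₄.symm, by simp, γ, hγ, h₃.symm,
      ⟨by simp, hγE⟩, hA, h₂, by simp⟩
  -- Entered with another color, the cell takes `0`, `colorA γ`, `d`, `colorA γ`. A single attached
  -- vertex cannot bar both candidates for `d`.
  · have : ∃ d, (d = colorB γ ∨ d = γ) ∧ ∀ m ∈ E, col m ≠ d := by
      rcases E with _ | ⟨m, _ | ⟨m', E⟩⟩
      · exact ⟨γ, by simp⟩
      · by_cases hm : col m = γ
        · exact ⟨colorB γ, Or.inl rfl, by simpa [hm] using h₃.symm⟩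
        · exact ⟨γ, Or.inr rfl, by simpa using hm⟩
      · simp at hE
    obtain ⟨d, hd, hdE⟩ := this
    exact ⟨0, by omega, fun e => hc e.symm, by simp, colorA γ, hA, h₁, by simp, d,
      by rcases hd with rfl | rfl <;> assumption, by rcases hd with rfl | rfl <;> omega,
      ⟨by rcases hd with rfl | rfl <;> simp, hdE⟩, hA,
      by rcases hd with rfl | rfl <;> omega, by simp⟩

/-- Every cell can be colored. -/
theorem exists_extends_cellLists' (hq : 3 ≤ q) (hγ : γ < q) (hcol : ∀ x < q, col x = x)
    (hE : E.length ≤ 1) (c : ℕ) : ∃ c', Extends col q c (cellLists q γ E) c' := by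
  by_cases h : c ≠ 0 ∨ ∀ m ∈ E, col m ≠ γ
  · obtain ⟨c', _, h'⟩ := exists_extends_cellLists hq hγ hcol hE c h
    exact ⟨c', h'⟩
  · push Not at h
    obtain ⟨rfl, m, hm, hmγ⟩ := h
    have h₁ := colorA_ne_zero (γ := γ)
    have h₂ := colorA_ne (γ := γ)
    have h₃ := colorB_ne (γ := γ)
    have h₄ := colorA_ne_colorB (γ := γ)
    have hA : colorA γ < q := colorA_lt hq
    have hB : colorB γ < q := colorB_lt hq
    -- The only attached vertex has the color `γ`, so it leaves `colorA γ` free for the third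
    -- vertex.
    refine ⟨0, (extends_cellLists_iff hcol _ _).2 ⟨colorA γ, hA, h₁, by simp, colorB γ, hB,
      h₄.symm, by simp, colorA γ, hA, h₄, ⟨by simp, fun m' hm' => ?_⟩, by omega, h₁.symm, by simp⟩⟩
    obtain rfl : m' = m := by
      rcases E with _ | ⟨x, _ | ⟨y, E⟩⟩
      · simp at hm
      · rw [List.mem_singleton] at hm hm'
        rw [hm, hm']
      · simp at hE
    rw [hmγ]
    exact h₂.symm

/-- A sequence of cells, followed by a vertex with the color `0`, cannot be colored if it starts with
the color `0` and all cells are blocked; otherwise it can be colored. -/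
theorem exists_extends_cells_iff (hq : 3 ≤ q) (hcol : ∀ x < q, col x = x)
    (cells : List (ℕ × List ℕ)) (hcells : ∀ x ∈ cells, x.1 < q ∧ x.2.length ≤ 1) (c' : ℕ) :
    Extends col q 0 (cells.flatMap (fun x => cellLists q x.1 x.2) ++ [others q [0]]) c' ↔
      c' = 0 ∧ ∃ x ∈ cells, ∀ m ∈ x.2, col m ≠ x.1 := by
  have hlast : ∀ c, Extends col q c [others q [0]] c' ↔ c ≠ 0 ∧ c' = 0 := by
    intro c
    simp only [Extends]
    constructor
    · rintro ⟨d, h₁, h₂, h₃, rfl⟩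
      have := (forall_others_append_iff (S := [0]) (E := []) hcol h₁).1 (by simpa using h₃)
      simp only [List.mem_singleton] at this
      omega
    · rintro ⟨h, rfl⟩
      refine ⟨0, by omega, h.symm, ?_, rfl⟩
      simpa using (forall_others_append_iff (S := [0]) (E := []) hcol (by omega : 0 < q)).2
  -- The closing vertex accepts exactly the nonzero signals, so it only matters whether some nonzero
  -- color can leave the row of cells.
  have htrans : ∀ cells : List (ℕ × List ℕ), (∀ x ∈ cells, x.1 < q ∧ x.2.length ≤ 1) → ∀ c,
      (∃ d ≠ 0, Extends col q c (cells.flatMap fun x => cellLists q x.1 x.2) d) ↔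
        (c ≠ 0 ∨ ∃ x ∈ cells, ∀ m ∈ x.2, col m ≠ x.1) := by
    intro cells
    induction cells with
    | nil => intro _ c; simp [Extends]
    | cons x cells ih =>
      intro hx c
      have ih := ih fun y hy => hx y (List.mem_cons_of_mem _ hy)
      obtain ⟨hx₁, hx₂⟩ := hx x List.mem_cons_self
      simp only [List.flatMap_cons, Extends.append_iff, List.exists_mem_cons_iff]
      constructor
      · rintro ⟨d, hd, e, he, hed⟩
        rcases (ih e).1 ⟨d, hd, hed⟩ with h | h
        · by_contra hcon
          push Not at hcon
          obtain ⟨rfl, h', _⟩ := hcon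
          exact h (eq_zero_of_extends_cellLists hcol h' he)
        · exact Or.inr (Or.inr h)
      · intro h
        by_cases h' : c ≠ 0 ∨ ∀ m ∈ x.2, col m ≠ x.1
        · obtain ⟨e, he, hce⟩ := exists_extends_cellLists hq hx₁ hcol hx₂ c h'
          obtain ⟨d, hd, hed⟩ := (ih e).2 (Or.inl he)
          exact ⟨d, hd, e, hce, hed⟩
        · obtain ⟨e, hce⟩ := exists_extends_cellLists' hq hx₁ hcol hx₂ c
          obtain ⟨d, hd, hed⟩ := (ih e).2 (Or.inr (by tauto))
          exact ⟨d, hd, e, hce, hed⟩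
  rw [Extends.append_iff]
  simp only [hlast]
  have := htrans cells hcells 0
  simp only [ne_eq, not_true_eq_false, false_or] at this
  rw [← this]
  constructor
  · rintro ⟨d, h, hd, hc'⟩
    exact ⟨hc', d, hd, h⟩
  · rintro ⟨hc', d, hd, h⟩
    exact ⟨d, h, hd, hc'⟩

end Cell

/-! ### The path of a clause. -/

/-- An entry of the table of the path vertices of a clause: the adjacent vertices of the palette,
and, for the third vertex of each cell, the index of its literal, the index of its digit and the
coloring of the group of vertices of the literal. -/
structure Entry (q p : ℕ) where
  pal : List ℕ
  slot : Option (ℕ × Fin p × (Fin p → Fin q))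

variable (q p : ℕ) {b : ℕ}

/-- The four entries of a cell. -/
def cell (i : ℕ) (r : Fin p) (w : Fin p → Fin q) : List (Entry q p) :=
  [⟨others q [0, colorA (w r)], none⟩, ⟨others q [colorA (w r), colorB (w r)], none⟩,
    ⟨others q [colorA (w r), colorB (w r), w r], some (i, r, w)⟩, ⟨others q [colorA (w r), 0], none⟩]

/-- The indices of the cells of a segment. -/
def cellIndices (s : ℕ) : List (Fin s × Fin p) :=
  List.finRange s ×ˢ List.finRange p

/-- The entries which belong to one coloring of the groups of the literals of a clause. -/
def segmentEntries (s : ℕ) (χ : Fin s → Fin p → Fin q) : List (Entry q p) :=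
  (cellIndices p s).flatMap (fun x => cell q p x.1 x.2 (χ x.1)) ++ [⟨others q [0], none⟩]

/-- The table of the path vertices of a clause with at most `s` literals. -/
noncomputable def table (s : ℕ) : List (Entry q p) :=
  (Finset.univ : Finset (Fin s → Fin p → Fin q)).toList.flatMap (segmentEntries q p s)

/-- A literal: the index of the group of its variable, the index of its variable in this group, and
its sign. -/
abbrev Literal (b : ℕ) : Type := ℕ × Fin b × Bool

/-- The further neighbor in the modulator of the third vertex of a cell. -/
def extra (D : (Fin p → Fin q) → Fin b → Bool) (C : List (Literal b)) :
    Option (ℕ × Fin p × (Fin p → Fin q)) → List ℕ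
  | none => []
  | some (i, r, w) => match C[i]? with
    | none => [(w r).1]
    | some l => if D w l.2.1 = l.2.2 then [] else [q + p * l.1 + r]

/-- The neighbors in the modulator of the path vertices of a clause. -/
noncomputable def clauseLists (s : ℕ) (D : (Fin p → Fin q) → Fin b → Bool) (C : List (Literal b)) :
    List (List ℕ) :=
  (table q p s).map fun e => e.pal ++ extra q p D C e.slot

variable {q p} {s : ℕ} {D : (Fin p → Fin q) → Fin b → Bool} {col : ℕ → ℕ}

/-- The coloring of a group of vertices. -/
def word (p : ℕ) (hcol : ∀ x, col x < q) (g : ℕ) (r : Fin p) : Fin q :=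
  ⟨col (q + p * g + r), hcol _⟩

theorem extra_length_le (C : List (Literal b)) (x : Option (ℕ × Fin p × (Fin p → Fin q))) :
    (extra q p D C x).length ≤ 1 := by
  rcases x with _ | ⟨i, r, w⟩
  · simp [extra]
  · simp only [extra]
    split
    · simp
    · split <;> simp

/-- A cell of a literal falsified by `χ` is attached to the digit of its group, and it blocks if
this digit agrees with `χ`. A cell of a literal satisfied by `χ` has no attached vertex and never
blocks. A cell of a missing literal is attached to the palette vertex of its own color and always
blocks. If `χ` assigns different colorings to two literals with the same group, the right-hand
condition cannot fail, and the segment is harmless. -/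
theorem extends_segmentEntries_iff (hq : 3 ≤ q) (hp : 0 < p) (hcollt : ∀ x, col x < q)
    (hcol : ∀ x < q, col x = x) (C : List (Literal b))
    (χ : Fin s → Fin p → Fin q) (c : ℕ) :
    Extends col q 0 ((segmentEntries q p s χ).map fun e => e.pal ++ extra q p D C e.slot) c ↔
      c = 0 ∧ ¬ ∀ i : Fin s, ∀ l, C[i.1]? = some l →
        D (χ i) l.2.1 ≠ l.2.2 ∧ word p hcollt l.1 = χ i := by
  have e : (segmentEntries q p s χ).map (fun e => e.pal ++ extra q p D C e.slot) =
      ((cellIndices p s).map fun x : Fin s × Fin p =>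
        ((χ x.1 x.2).1, extra q p D C (some (x.1.1, x.2, χ x.1)))).flatMap
          (fun x => cellLists q x.1 x.2) ++ [others q [0]] := by
    simp [segmentEntries, List.map_flatMap, List.flatMap_map, cell, cellLists, extra]
  rw [e, exists_extends_cells_iff hq hcol]
  · refine and_congr_right fun _ => ?_
    rw [← not_iff_not, not_not]
    simp only [List.mem_map]
    push Not
    constructor
    · intro h i l hl
      have h' : ∀ r : Fin p, D (χ i) l.2.1 ≠ l.2.2 ∧ col (q + p * l.1 + r) = (χ i r).1 := by
        intro r
        obtain ⟨m, hm, hmγ⟩ := h _ ⟨(i, r), by simp [cellIndices], rfl⟩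
        simp only [extra, hl] at hm
        split at hm
        · simp at hm
        · rw [List.mem_singleton] at hm
          subst hm
          exact ⟨by assumption, hmγ⟩
      -- A group needs at least one digit: without cells, a satisfied literal could not unblock the
      -- segment.
      exact ⟨(h' ⟨0, hp⟩).1, funext fun r => Fin.ext (h' r).2⟩
    · rintro h _ ⟨⟨i, r⟩, _, rfl⟩
      cases hl : C[i.1]? with
      | none => exact ⟨(χ i r).1, by simp [extra, hl], hcol _ (Fin.is_lt _)⟩
      | some l =>
        obtain ⟨h₁, h₂⟩ := h i l hl
        exact ⟨q + p * l.1 + r, by simp [extra, hl, h₁], congrArg Fin.val (congrFun h₂ r)⟩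
  · simp only [List.mem_map]
    rintro _ ⟨x, _, rfl⟩
    refine ⟨Fin.is_lt _, ?_⟩
    exact extra_length_le (D := D) C (some (x.1.1, x.2, χ x.1))

/-- The path of a clause can be colored if and only if the coloring of the groups satisfies the
clause. -/
theorem extends_clauseLists_iff (hq : 3 ≤ q) (hp : 0 < p) (hcollt : ∀ x, col x < q)
    (hcol : ∀ x < q, col x = x) (C : List (Literal b)) (hC : C.length ≤ s) (c : ℕ) :
    Extends col q 0 (clauseLists q p s D C) c ↔
      c = 0 ∧ ∃ l ∈ C, D (word p hcollt l.1) l.2.1 = l.2.2 := by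
  -- Each segment is left with the color `0` with which the next one is entered, so the conditions
  -- simply add up.
  have key : ∀ X : List (Fin s → Fin p → Fin q),
      Extends col q 0 ((X.flatMap (segmentEntries q p s)).map fun e => e.pal ++ extra q p D C e.slot) c ↔
      c = 0 ∧ ∀ χ ∈ X, ¬ ∀ i : Fin s, ∀ l, C[i.1]? = some l →
        D (χ i) l.2.1 ≠ l.2.2 ∧ word p hcollt l.1 = χ i := by
    intro X
    induction X with
    | nil => simpa [Extends] using eq_comm
    | cons χ X ih =>
      rw [List.flatMap_cons, List.map_append, Extends.append_iff]
      simp only [extends_segmentEntries_iff hq hp hcollt hcol C, List.forall_mem_cons]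
      constructor
      · rintro ⟨d, ⟨rfl, h⟩, h'⟩
        exact ⟨(ih.1 h').1, h, (ih.1 h').2⟩
      · rintro ⟨hc, h, h'⟩
        exact ⟨0, ⟨rfl, h⟩, ih.2 ⟨hc, h'⟩⟩
  rw [clauseLists, table, key]
  refine and_congr_right fun _ => ⟨fun h => ?_, ?_⟩
  · by_contra hcon
    push Not at hcon
    -- The violated segment is the one whose `χ` is read off from the coloring itself; the value at
    -- missing literals is arbitrary.
    refine h (fun i => if hi : i.1 < C.length then word p hcollt C[i.1].1
      else fun _ => ⟨0, by omega⟩) (by simp) fun i l hl => ?_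
    obtain ⟨hi, rfl⟩ := List.getElem?_eq_some_iff.1 hl
    simp only [hi, dif_pos, and_true]
    exact hcon _ (List.getElem_mem hi)
  · rintro ⟨l, hl, hD⟩ χ _ h
    obtain ⟨i, hi, rfl⟩ := List.getElem_of_mem hl
    obtain ⟨h₁, h₂⟩ := h ⟨i, by omega⟩ _ (List.getElem?_eq_getElem hi)
    rw [h₂] at hD
    exact h₁ hD

end ClauseGadget

/-! ### The path of a formula. -/

namespace ClauseGadget

variable (q p s : ℕ) {b : ℕ} [NeZero b] (D : (Fin p → Fin q) → Fin b → Bool)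

/-- The group of a variable, its index in this group, and the sign of a literal. -/
def literal (b : ℕ) [NeZero b] {n : ℕ} (l : Fin n × Bool) : Literal b :=
  (l.1 / b, Fin.ofNat b l.1, l.2)

/-- The neighbors in the modulator of the path vertices of the clauses of a formula. -/
noncomputable def formulaLists (φ : CNFFormula) : List (List ℕ) :=
  φ.clauses.flatMap fun C => clauseLists q p s D (C.map (literal b))

/-- The number of modulator vertices for a formula on `n` variables. -/
def modulatorSize (q p b n : ℕ) : ℕ := q + p * (n / b + 1)

variable {q p s D}

/-- The additional first vertex, with the list `{0}`, supplies the entry color `0` of the first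
clause, and every clause hands it on. -/
theorem extends_formulaLists_iff {col : ℕ → ℕ} (hq : 3 ≤ q) (hp : 0 < p) (hcollt : ∀ x, col x < q)
    (hcol : ∀ x < q, col x = x) (φ : CNFFormula) (hφ : φ.HasWidthAtMost s) :
    (∃ c, Extends col q q (others q [0] :: formulaLists q p s D φ) c) ↔
      ∀ C ∈ φ.clauses, ∃ l ∈ C, D (word p hcollt (l.1 / b)) (Fin.ofNat b l.1) = l.2 := by
  have key : ∀ X : List (List (Fin φ.numVars × Bool)), (∀ C ∈ X, C.length ≤ s) → ∀ c,
      (Extends col q 0 (X.flatMap fun C => clauseLists q p s D (C.map (literal b))) c ↔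
        c = 0 ∧ ∀ C ∈ X, ∃ l ∈ C, D (word p hcollt (l.1 / b)) (Fin.ofNat b l.1) = l.2) := by
    intro X hX c
    induction X with
    | nil => simpa [Extends] using eq_comm
    | cons C X ih =>
      have ih := ih fun C' hC' => hX C' (List.mem_cons_of_mem _ hC')
      have hC : (C.map (literal b)).length ≤ s := by simpa using hX C List.mem_cons_self
      rw [List.flatMap_cons, Extends.append_iff]
      simp only [extends_clauseLists_iff hq hp hcollt hcol _ hC, List.forall_mem_cons,
        List.mem_map, exists_exists_and_eq_and, literal]
      constructor
      · rintro ⟨d, ⟨rfl, h⟩, h'⟩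
        exact ⟨(ih.1 h').1, h, (ih.1 h').2⟩
      · rintro ⟨hc, h, h'⟩
        exact ⟨0, ⟨rfl, h⟩, ih.2 ⟨hc, h'⟩⟩
  have hfirst := fun d hd => forall_others_append_iff (q := q) (S := [0]) (E := []) hcol (d := d) hd
  simp only [List.append_nil, List.mem_singleton, List.not_mem_nil, false_imp_iff, implies_true,
    and_true] at hfirst
  constructor
  · rintro ⟨c, d, hd, _, h₀, h⟩
    obtain rfl := (hfirst d hd).1 h₀
    exact ((key _ hφ c).1 h).2
  · intro h
    exact ⟨0, 0, by omega, by omega, (hfirst 0 (by omega)).2 rfl, (key _ hφ 0).2 ⟨rfl, h⟩⟩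

/-- Any coloring of the groups decodes to an assignment through `D`. Conversely, surjectivity of `D`
gives each group a coloring that decodes to the prescribed values of its block. -/
theorem satisfiable_iff (hq : 3 ≤ q) (hp : 0 < p) (hD : Function.Surjective D) (φ : CNFFormula)
    (hφ : φ.HasWidthAtMost s) :
    φ.Satisfiable ↔ ∃ col : ℕ → ℕ, (∀ x, col x < q) ∧ (∀ x < q, col x = x) ∧
      ∃ c, Extends col q q (others q [0] :: formulaLists q p s D φ) c := by
  have hb : 0 < b := Nat.pos_of_neZero b
  constructor
  · rintro ⟨v, hv⟩
    -- The last block may reach beyond the variables of the formula; the surplus positions get the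
    -- value `false`.
    choose w hw using fun g : ℕ => hD fun j : Fin b =>
      if h : b * g + j.1 < φ.numVars then v ⟨b * g + j.1, h⟩ else false
    let col : ℕ → ℕ := fun x => if x < q then x else
      (w ((x - q) / p) ⟨(x - q) % p, Nat.mod_lt _ hp⟩).1
    have hcollt : ∀ x, col x < q := by
      intro x
      simp only [col]
      split
      · assumption
      · exact Fin.is_lt _
    have hcol : ∀ x < q, col x = x := fun x hx => if_pos hx
    refine ⟨col, hcollt, hcol, (extends_formulaLists_iff hq hp hcollt hcol φ hφ).2 ?_⟩
    have hword : ∀ g, word p hcollt g = w g := by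
      intro g
      funext r
      ext
      simp only [word, col]
      rw [if_neg (by omega)]
      have e : q + p * g + r - q = p * g + r := by omega
      simp only [e, Nat.mul_add_mod, Nat.mod_eq_of_lt r.2, Nat.mul_add_div hp,
        Nat.div_eq_of_lt r.2, add_zero]
    intro C hC
    obtain ⟨l, hl, hvl⟩ := hv C hC
    refine ⟨l, hl, ?_⟩
    rw [hword, hw]
    simp [Fin.ofNat, Nat.div_add_mod, hvl]
  · rintro ⟨col, hcollt, hcol, h⟩
    rw [extends_formulaLists_iff hq hp hcollt hcol φ hφ] at h
    exact ⟨fun x => D (word p hcollt (x / b)) (Fin.ofNat b x), h⟩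

theorem lt_of_mem_others {S : List ℕ} {x : ℕ} (h : x ∈ others q S) : x < q := by
  simp only [others, List.mem_filter, List.mem_range] at h
  exact h.1

theorem lt_of_mem_pal {e : Entry q p} (he : e ∈ table q p s) {x : ℕ} (hx : x ∈ e.pal) : x < q := by
  simp only [table, segmentEntries, cell, List.mem_flatMap, List.mem_append, List.mem_cons,
    List.not_mem_nil, or_false] at he
  obtain ⟨χ, _, ⟨y, _, rfl | rfl | rfl | rfl⟩ | rfl⟩ := he <;> exact lt_of_mem_others hx

theorem lt_of_mem_clauseLists {n : ℕ} (C : List (Fin n × Bool)) {N : List ℕ}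
    (hN : N ∈ clauseLists q p s D (C.map (literal b))) {x : ℕ} (hx : x ∈ N) :
    x < modulatorSize q p b n := by
  have hle : q ≤ modulatorSize q p b n := Nat.le_add_right _ _
  obtain ⟨e, he, rfl⟩ := List.mem_map.1 hN
  rcases List.mem_append.1 hx with hx | hx
  · exact (lt_of_mem_pal he hx).trans_le hle
  · rcases hs : e.slot with _ | ⟨i, r, w⟩
    · simp [hs, extra] at hx
    · rw [hs] at hx
      simp only [extra, List.getElem?_map] at hx
      cases hl : C[i]? with
      | none =>
        simp only [hl, Option.map_none, List.mem_singleton] at hx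
        rw [hx]
        exact (Fin.is_lt _).trans_le hle
      | some l =>
        simp only [hl, Option.map_some, literal] at hx
        split at hx
        · simp at hx
        · rw [List.mem_singleton] at hx
          have h₁ : (l.1 : ℕ) / b ≤ n / b := Nat.div_le_div_right l.1.2.le
          have h₂ := Nat.mul_le_mul_left p h₁
          have := r.2
          rw [hx, modulatorSize, mul_add]
          omega

theorem lt_of_mem_formulaLists (φ : CNFFormula) {N : List ℕ}
    (hN : N ∈ others q [0] :: formulaLists q p s D φ) {x : ℕ} (hx : x ∈ N) :
    x < modulatorSize q p b φ.numVars := by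
  rcases List.mem_cons.1 hN with rfl | hN
  · exact (lt_of_mem_others hx).trans_le (Nat.le_add_right _ _)
  · obtain ⟨C, _, hN⟩ := List.mem_flatMap.1 hN
    exact lt_of_mem_clauseLists C hN hx

end ClauseGadget

/-! ### Running times of structured programs. -/

namespace StackProgram

/-- Started in `s`, the program `P` ends in `s'` after at most `T` steps. -/
def Runs {K A σ : Type} [DecidableEq K] (P : Prog K A σ) (s : State K A σ) (T : ℕ)
    (s' : State K A σ) : Prop :=
  ∃ t ≤ T, Exec P s t s'

section

variable {K A σ : Type} [DecidableEq K] {P Q : Prog K A σ} {s s' s'' : State K A σ} {T T' : ℕ}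

theorem Runs.mono (h : Runs P s T s') (hT : T ≤ T') : Runs P s T' s' :=
  let ⟨t, ht, h⟩ := h
  ⟨t, ht.trans hT, h⟩

theorem Runs.congr (h : Runs P s T s') (e : s' = s'') : Runs P s T s'' := e ▸ h

theorem Runs.congr' (h : Runs P s' T s'') (e : s = s') : Runs P s T s'' := e ▸ h

theorem Runs.op (o : Op K A σ) (s : State K A σ) : Runs (.op o) s 1 (o.run s) :=
  ⟨1, le_rfl, .op o s⟩

theorem Runs.seq (h : Runs P s T s') (h' : Runs Q s' T' s'') :
    Runs (.seq P Q) s (T + T') s'' :=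
  let ⟨t, ht, h⟩ := h
  let ⟨t', ht', h'⟩ := h'
  ⟨t + t', add_le_add ht ht', .seq h h'⟩

theorem Runs.ite_true {c : σ → Bool} (hc : c s.var = true) (h : Runs P s T s') :
    Runs (.ite c P Q) s (1 + T) s' :=
  let ⟨t, ht, h⟩ := h
  ⟨1 + t, by omega, .ite_true hc h⟩

theorem Runs.ite_false {c : σ → Bool} (hc : c s.var = false) (h : Runs Q s T s') :
    Runs (.ite c P Q) s (1 + T) s' :=
  let ⟨t, ht, h⟩ := h
  ⟨1 + t, by omega, .ite_false hc h⟩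

theorem Runs.loop_false {c : σ → Bool} (hc : c s.var = false) : Runs (.loop c P) s 1 s :=
  ⟨1, le_rfl, .loop_false hc⟩

theorem Runs.loop_true {c : σ → Bool} (hc : c s.var = true) (h : Runs P s T s')
    (h' : Runs (.loop c P) s' T' s'') : Runs (.loop c P) s (1 + T + T') s'' :=
  let ⟨t, ht, h⟩ := h
  let ⟨t', ht', h'⟩ := h'
  ⟨1 + t + t', by omega, .loop_true hc h h'⟩

theorem Op.out_length_run_le (o : Op K A σ) (s : State K A σ) :
    (o.run s).out.length ≤ s.out.length + 1 := by
  cases o <;> simp [Op.run]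

/-- The length of the output is bounded by the number of steps. -/
theorem Exec.out_length_le {t : ℕ} (h : Exec P s t s') : s'.out.length ≤ s.out.length + t := by
  induction h with
  | op o s => exact o.out_length_run_le s
  | seq _ _ ih ih' => omega
  | ite_true _ _ ih => omega
  | ite_false _ _ ih => omega
  | loop_false _ => omega
  | loop_true _ _ _ ih ih' => omega

end

end StackProgram

/-! ### Subroutines for unary numbers and for the output. -/

namespace ReductionProgram

open StackProgram Computability

/-- The working stacks of the reduction: the input, the word of the vertices which have been
created, a stack for temporary use, and a counter for the group of the current literal. -/
inductive Reg
  | inp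
  | base
  | tmp
  | grp
  deriving DecidableEq

instance : Fintype Reg := ⟨{Reg.inp, Reg.base, Reg.tmp, Reg.grp}, fun x => by cases x <;> simp⟩

/-- The variables of the reduction: a symbol, an index in a group, and the sign of a literal. -/
abbrev Var (b : ℕ) : Type := Option Γ' × Fin b × Bool

variable {b : ℕ}

/-- The symbol of unary words. -/
abbrev one : Γ' := Γ'.bit true

theorem unaryWord_append (m n : ℕ) : unaryWord m ++ unaryWord n = unaryWord (m + n) :=
  List.replicate_append_replicate

/-- The program which does nothing. -/
def skip : Prog Reg Γ' (Var b) := .op (.load id)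

theorem run_skip (s : State Reg Γ' (Var b)) : Runs skip s 1 s := Runs.op _ _

/-- Write the word `w` to the output. -/
def emitWord : List Γ' → Prog Reg Γ' (Var b)
  | [] => skip
  | a :: w => .seq (emitWord w) (.op (.emit fun _ => a))

theorem run_emitWord (w : List Γ') (s : State Reg Γ' (Var b)) :
    Runs (emitWord w) s (w.length + 1) { s with out := w ++ s.out } := by
  induction w with
  | nil => exact run_skip s
  | cons a w ih => exact ih.seq (Runs.op _ _)

/-- Push the word `a ^ n` to the stack `k`. -/
def pushN (k : Reg) (a : Γ') : ℕ → Prog Reg Γ' (Var b)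
  | 0 => skip
  | n + 1 => .seq (pushN k a n) (.op (.push k fun _ => a))

theorem run_pushN (k : Reg) (a : Γ') (n : ℕ) (s : State Reg Γ' (Var b)) :
    Runs (pushN k a n) s (n + 1)
      { s with stk := Function.update s.stk k (List.replicate n a ++ s.stk k) } := by
  induction n with
  | zero =>
    refine (run_skip s).congr ?_
    simp
  | succ n ih =>
    refine (ih.seq (Runs.op _ _)).congr ?_
    simp [Op.run, List.replicate_succ]

/-- Replace the symbol in the variable by the first symbol of the stack `k`, and remove it. -/
def popSym (k : Reg) : Prog Reg Γ' (Var b) := .op (.pop k fun v a => (a, v.2))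

/-- Whether there is a symbol in the variable. -/
def hasSym (v : Var b) : Bool := v.1.isSome

/-- Write the number of elements of the stack `k` to the output in unary. -/
def copy (k : Reg) : Prog Reg Γ' (Var b) :=
  .seq (popSym k) <|
  .seq (.loop hasSym <|
    .seq (.op (.push Reg.tmp fun v => v.1.getD Γ'.blank)) <|
    .seq (.op (.emit fun _ => one)) (popSym k)) <|
  .seq (popSym Reg.tmp) <|
  .loop hasSym (.seq (.op (.push k fun v => v.1.getD Γ'.blank)) (popSym Reg.tmp))

/-- The stack is poured into `Reg.tmp`, with one output symbol per element, and poured back, so that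
the two reversals cancel. Both loops hold the next symbol in the variable, hence `head?` and `tail`
in their invariants. -/
theorem run_copy {k : Reg} (hk : k ≠ Reg.tmp) (x : Option Γ') (pos : Fin b) (sg : Bool)
    (S : Reg → List Γ') (hS : S Reg.tmp = []) (o : List Γ') :
    Runs (copy k) ⟨(x, pos, sg), S, o⟩ (7 * (S k).length + 4)
      ⟨(none, pos, sg), S, unaryWord (S k).length ++ o⟩ := by
  have h₁ : ∀ (l t o : List Γ'), Runs (.loop hasSym <|
      .seq (.op (.push Reg.tmp fun v => v.1.getD Γ'.blank)) <|
      .seq (.op (.emit fun _ => one)) (popSym k) : Prog Reg Γ' (Var b))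
      ⟨(l.head?, pos, sg), Function.update (Function.update S k l.tail) Reg.tmp t, o⟩
      (4 * l.length + 1)
      ⟨(none, pos, sg), Function.update (Function.update S k []) Reg.tmp (l.reverse ++ t),
        unaryWord l.length ++ o⟩ := by
    intro l
    induction l with
    | nil => exact fun t o => Runs.loop_false rfl
    | cons a l ih =>
      intro t o
      have ih := ih (a :: t) (one :: o)
      have e : unaryWord l.length ++ one :: o = unaryWord (a :: l).length ++ o := by
        rw [List.length_cons, ← unaryWord_append]
        simp [unaryWord]
      rw [e, show l.reverse ++ a :: t = (a :: l).reverse ++ t by simp] at ih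
      refine (Runs.loop_true rfl ((Runs.op _ _).seq ((Runs.op _ _).seq (Runs.op _ _))) ?_).mono
        (T := 1 + (1 + (1 + 1)) + (4 * l.length + 1)) (by simp; omega)
      refine ih.congr' ?_
      simp only [Op.run]
      congr 1
      · simp [hk]
      · funext j
        by_cases h₁ : j = k <;> by_cases h₂ : j = Reg.tmp <;> simp_all [Function.update]
  have h₂ : ∀ l t : List Γ', Runs (.loop hasSym (.seq (.op (.push k fun v => v.1.getD Γ'.blank))
      (popSym Reg.tmp)) : Prog Reg Γ' (Var b))
      ⟨(l.head?, pos, sg), Function.update (Function.update S k t) Reg.tmp l.tail,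
        unaryWord (S k).length ++ o⟩ (3 * l.length + 1)
      ⟨(none, pos, sg), Function.update (Function.update S k (l.reverse ++ t)) Reg.tmp [],
        unaryWord (S k).length ++ o⟩ := by
    intro l
    induction l with
    | nil => exact fun t => Runs.loop_false rfl
    | cons a l ih =>
      intro t
      have ih := ih (a :: t)
      rw [show l.reverse ++ a :: t = (a :: l).reverse ++ t by simp] at ih
      refine (Runs.loop_true rfl ((Runs.op _ _).seq (Runs.op _ _)) ?_).mono
        (T := 1 + (1 + 1) + (3 * l.length + 1)) (by simp; omega)
      refine ih.congr' ?_
      simp only [Op.run]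
      congr 1
      · simp [hk.symm]
      · funext j
        by_cases h₁ : j = k <;> by_cases h₂ : j = Reg.tmp <;> simp_all [Function.update]
  have h₁ := h₁ (S k) [] o
  have h₂ := h₂ (S k).reverse []
  rw [List.length_reverse, List.reverse_reverse, List.append_nil, Function.update_eq_self,
    ← hS, Function.update_eq_self] at h₂
  rw [List.append_nil] at h₁
  refine ((Runs.op _ _).seq (.seq (h₁.congr' ?_) ((Runs.op _ _).seq (h₂.congr' ?_)))).mono ?_
  · simp only [Op.run]
    congr 1
    funext j
    by_cases h : j = Reg.tmp
    · subst h; simp [hS, hk.symm]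
    · simp [h]
  · simp [Op.run, hS]
  · omega

end ReductionProgram

namespace ReductionProgram

open StackProgram Computability

variable {b : ℕ}

/-- The stacks which serve as counters. -/
inductive Counter
  | base
  | grp

/-- The stack of a counter. -/
def Counter.reg : Counter → Reg
  | base => Reg.base
  | grp => Reg.grp

theorem Counter.reg_ne_tmp (c : Counter) : c.reg ≠ Reg.tmp := by cases c <;> simp [Counter.reg]

theorem Counter.reg_ne_inp (c : Counter) : c.reg ≠ Reg.inp := by cases c <;> simp [Counter.reg]

/-- A number which is the sum of an optional counter and a constant. -/
abbrev Num : Type := Option Counter × ℕ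

/-- The value of a number. -/
def Num.val (S : Reg → List Γ') : Num → ℕ
  | (none, n) => n
  | (some c, n) => (S c.reg).length + n

/-- Write a number to the output in unary. -/
def emitNum : Num → Prog Reg Γ' (Var b)
  | (none, n) => emitWord (unaryWord n)
  | (some c, n) => .seq (emitWord (unaryWord n)) (copy c.reg)

/-- The values of the counters are at most `W`, and the stack for temporary use is empty. -/
structure Bounded (S : Reg → List Γ') (W : ℕ) : Prop where
  tmp : S Reg.tmp = []
  le : ∀ c : Counter, (S c.reg).length ≤ W

theorem run_emitNum (x : Num) (y : Fin b × Bool) {S : Reg → List Γ'} {W : ℕ} (hS : Bounded S W)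
    (o : List Γ') :
    Runs (emitNum x) ⟨(none, y), S, o⟩ ((x.2 + 12) * (W + 1))
      ⟨(none, y), S, unaryWord (x.val S) ++ o⟩ := by
  obtain ⟨_ | c, n⟩ := x
  · refine (run_emitWord _ _).mono ?_
    simp only [unaryWord, List.length_replicate]
    nlinarith
  · refine (((run_emitWord _ _).seq (run_copy c.reg_ne_tmp _ _ _ _ hS.tmp _)).congr ?_).mono ?_
    · simp only [Num.val, ← unaryWord_append, List.append_assoc]
    · have := hS.le c
      simp only [unaryWord, List.length_replicate]
      nlinarith

/-- The code of an edge. -/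
def encodePair (x : ℕ × ℕ) : List Γ' :=
  Γ'.bra :: (unaryWord x.1 ++ Γ'.comma :: (unaryWord x.2 ++ [Γ'.ket]))

/-- Write the code of an edge to the output. -/
def emitEdge (x y : Num) : Prog Reg Γ' (Var b) :=
  .seq (emitWord [Γ'.ket]) <| .seq (emitNum y) <| .seq (emitWord [Γ'.comma]) <|
    .seq (emitNum x) <| emitWord [Γ'.bra]

theorem run_emitEdge (x x' : Num) (y : Fin b × Bool) {S : Reg → List Γ'} {W : ℕ}
    (hS : Bounded S W) (o : List Γ') :
    Runs (emitEdge x x') ⟨(none, y), S, o⟩ ((x.2 + x'.2 + 30) * (W + 1))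
      ⟨(none, y), S, encodePair (x.val S, x'.val S) ++ o⟩ := by
  refine (((run_emitWord _ _).seq ((run_emitNum x' y hS _).seq ((run_emitWord _ _).seq
    ((run_emitNum x y hS _).seq (run_emitWord _ _))))).congr ?_).mono ?_
  · simp [encodePair]
  · simp only [List.length_cons, List.length_nil]
    nlinarith

/-- An edge which is written to the output if the guard holds. -/
structure Template (b : ℕ) where
  guard : Fin b × Bool → Bool
  fst : Num
  snd : Num

/-- The edge of a template. -/
def Template.edge (S : Reg → List Γ') (e : Template b) : ℕ × ℕ :=
  (e.fst.val S, e.snd.val S)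

/-- Write the edges whose guards hold to the output. -/
def emitEdges : List (Template b) → Prog Reg Γ' (Var b)
  | [] => skip
  | e :: l => .seq (emitEdges l) (.ite (fun v => e.guard v.2) (emitEdge e.fst e.snd) skip)

/-- Guards are evaluated in the finite control, so `K` depends on the templates alone. The tail of
the list is written before its head because output symbols are pushed in front. -/
theorem run_emitEdges (l : List (Template b)) : ∃ K, ∀ (y : Fin b × Bool) (S : Reg → List Γ')
    (W : ℕ) (_ : Bounded S W) (o : List Γ'),
    Runs (emitEdges l) ⟨(none, y), S, o⟩ (K * (W + 1))
      ⟨(none, y), S, ((l.filter (·.guard y)).map (·.edge S)).flatMap encodePair ++ o⟩ := by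
  induction l with
  | nil => exact ⟨1, fun y S W _ o => (run_skip _).mono (by omega)⟩
  | cons e l ih =>
    obtain ⟨K, hK⟩ := ih
    refine ⟨K + (e.fst.2 + e.snd.2 + 32), fun y S W hS o => ?_⟩
    rw [add_mul]
    refine (hK y S W hS o).seq ?_
    by_cases h : e.guard y = true
    · refine ((Runs.ite_true h (run_emitEdge _ _ _ hS _)).congr ?_).mono (by nlinarith)
      simp [h, Template.edge]
    · rw [Bool.not_eq_true] at h
      refine ((Runs.ite_false h (run_skip _)).congr ?_).mono (by nlinarith)
      simp [h]

/-- Empty the stack `k`. -/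
def clear (k : Reg) : Prog Reg Γ' (Var b) := .seq (popSym k) (.loop hasSym (popSym k))

theorem run_clear (k : Reg) (x : Option Γ') (y : Fin b × Bool) (S : Reg → List Γ') (o : List Γ') :
    Runs (clear k) ⟨(x, y), S, o⟩ (2 * (S k).length + 2)
      ⟨(none, y), Function.update S k [], o⟩ := by
  have h : ∀ l : List Γ', Runs (.loop hasSym (popSym k) : Prog Reg Γ' (Var b))
      ⟨(l.head?, y), Function.update S k l.tail, o⟩ (2 * l.length + 1)
      ⟨(none, y), Function.update S k [], o⟩ := by
    intro l
    induction l with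
    | nil => exact Runs.loop_false rfl
    | cons a l ih =>
      refine (Runs.loop_true rfl (Runs.op _ _) (ih.congr' ?_)).mono (T := 1 + 1 + _) (by
        simp; omega)
      simp [Op.run]
  exact ((Runs.op _ _).seq (h (S k))).mono (by omega)

/-- Move the content of the stack `k` to the output. -/
def flush (k : Reg) : Prog Reg Γ' (Var b) :=
  .seq (popSym k) (.loop hasSym (.seq (.op (.emit fun v => v.1.getD Γ'.blank)) (popSym k)))

theorem run_flush (k : Reg) (x : Option Γ') (y : Fin b × Bool) (S : Reg → List Γ') (o : List Γ') :
    Runs (flush k) ⟨(x, y), S, o⟩ (3 * (S k).length + 2)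
      ⟨(none, y), Function.update S k [], (S k).reverse ++ o⟩ := by
  have h : ∀ l o : List Γ', Runs (.loop hasSym (.seq (.op (.emit fun v => v.1.getD Γ'.blank))
      (popSym k)) : Prog Reg Γ' (Var b))
      ⟨(l.head?, y), Function.update S k l.tail, o⟩ (3 * l.length + 1)
      ⟨(none, y), Function.update S k [], l.reverse ++ o⟩ := by
    intro l
    induction l with
    | nil => exact fun o => Runs.loop_false rfl
    | cons a l ih =>
      intro o
      have ih := ih (a :: o)
      rw [show l.reverse ++ a :: o = (a :: l).reverse ++ o by simp] at ih
      refine (Runs.loop_true rfl ((Runs.op _ _).seq (Runs.op _ _)) (ih.congr' ?_)).mono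
        (T := 1 + (1 + 1) + _) (by simp; omega)
      simp [Op.run]
  exact ((Runs.op _ _).seq (h (S k) o)).mono (by omega)

/-- Look at the first symbol of the input. -/
def peekInp : Prog Reg Γ' (Var b) := .op (.peek Reg.inp fun v a => (a, v.2))

/-- Remove the first symbol of the input. -/
def dropInp : Prog Reg Γ' (Var b) := .op (.pop Reg.inp fun v _ => v)

/-- Forget the symbol in the variable. -/
def clearSym : Prog Reg Γ' (Var b) := .op (.load fun v => (none, v.2))

/-- Set the variable to its initial value. -/
def reset [NeZero b] : Prog Reg Γ' (Var b) := .op (.load fun _ => (none, 0, false))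

/-- Count one element: every `b` times, add `p` to the counter. -/
def tick [NeZero b] (c : Counter) (p : ℕ) : Prog Reg Γ' (Var b) :=
  .ite (fun v => decide (v.2.1.1 + 1 = b))
    (.seq (.op (.load fun v => (v.1, 0, v.2.2))) (pushN c.reg one p))
    (.op (.load fun v => (v.1, v.2.1 + 1, v.2.2)))

/-- Read a number `x` in unary from the input, and add `p * (x / b)` to the counter. -/
def readUnary [NeZero b] (c : Counter) (p : ℕ) : Prog Reg Γ' (Var b) :=
  .seq peekInp <| .seq
    (.loop (fun v => decide (v.1 = some one)) (.seq dropInp (.seq (tick c p) peekInp))) clearSym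

/-- After `y` ticks the variable holds `y` modulo `b` and `p * (y / b)` symbols have been added to
the counter: division by the constant `b` needs only the finite control. -/
theorem run_tick [NeZero b] (c : Counter) (p y : ℕ) (x : Option Γ') (sg : Bool)
    (S : Reg → List Γ') (g o : List Γ') :
    Runs (tick c p) ⟨(x, Fin.ofNat b y, sg), Function.update S c.reg (unaryWord (p * (y / b)) ++ g),
      o⟩ (p + 3) ⟨(x, Fin.ofNat b (y + 1), sg),
        Function.update S c.reg (unaryWord (p * ((y + 1) / b)) ++ g), o⟩ := by
  have hb : 0 < b := Nat.pos_of_neZero b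
  by_cases h : y % b + 1 = b
  · have hdvd : b ∣ y + 1 := by
      refine Nat.dvd_of_mod_eq_zero ?_
      rw [Nat.add_mod_eq_add_mod_right 1 (Nat.mod_mod y b).symm, h, Nat.mod_self]
    refine ((Runs.ite_true (by simpa [Fin.ofNat] using h)
      ((Runs.op _ _).seq (run_pushN _ _ _ _))).congr ?_).mono (by omega)
    have e : (0 : Fin b) = Fin.ofNat b (y + 1) := by
      ext
      simp [Fin.ofNat, Nat.mod_eq_zero_of_dvd hdvd]
    simp only [Op.run, Function.update_self, Function.update_idem, e, Nat.succ_div_of_dvd hdvd,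
      mul_add, mul_one]
    rw [← List.append_assoc, add_comm (p * (y / b)), ← unaryWord_append]
    rfl
  · have hdvd : ¬ b ∣ y + 1 := by
      intro hd
      have := Nat.mod_lt y hb
      have h₀ := Nat.mod_eq_zero_of_dvd hd
      rw [Nat.add_mod_eq_add_mod_right 1 (Nat.mod_mod y b).symm, Nat.mod_eq_of_lt (by omega)] at h₀
      omega
    refine ((Runs.ite_false (by simpa [Fin.ofNat] using h) (Runs.op _ _)).congr ?_).mono (by omega)
    have e : Fin.ofNat b y + 1 = Fin.ofNat b (y + 1) := by
      ext
      simp [Fin.ofNat, Fin.val_add]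
    simp only [Op.run, e, Nat.succ_div_of_not_dvd hdvd]

/-- The reading loop is a sequence of ticks; `hrest` ensures that it stops at the end of the number.
-/
theorem run_readUnary [NeZero b] (c : Counter) (p x : ℕ) (x₀ : Option Γ') (sg : Bool)
    (S : Reg → List Γ') (rest o : List Γ') (hS : S Reg.inp = unaryWord x ++ rest)
    (hrest : rest.head? ≠ some one) :
    Runs (readUnary c p) ⟨(x₀, 0, sg), S, o⟩ ((p + 6) * x + 3)
      ⟨(none, Fin.ofNat b x, sg), Function.update (Function.update S Reg.inp rest) c.reg
        (unaryWord (p * (x / b)) ++ S c.reg), o⟩ := by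
  have h : ∀ z y, Runs (.loop (fun v => decide (v.1 = some one))
      (.seq dropInp (.seq (tick c p) peekInp)) : Prog Reg Γ' (Var b))
      ⟨((unaryWord z ++ rest).head?, Fin.ofNat b y, sg),
        Function.update (Function.update S Reg.inp (unaryWord z ++ rest)) c.reg
          (unaryWord (p * (y / b)) ++ S c.reg), o⟩ ((p + 6) * z + 1)
      ⟨(rest.head?, Fin.ofNat b (y + z), sg), Function.update (Function.update S Reg.inp rest) c.reg
        (unaryWord (p * ((y + z) / b)) ++ S c.reg), o⟩ := by
    intro z
    induction z with
    | zero =>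
      intro y
      refine (Runs.loop_false ?_).mono (by omega)
      exact decide_eq_false hrest
    | succ z ih =>
      intro y
      have ih := ih (y + 1)
      rw [add_assoc, add_comm 1 z] at ih
      refine (Runs.loop_true rfl ((Runs.op _ _).seq (((run_tick c p y (some one) sg
        (Function.update S Reg.inp (unaryWord z ++ rest)) (S c.reg) o).congr' ?_).seq
          (Runs.op _ _))) (ih.congr' ?_)).mono (T := 1 + (1 + (p + 3 + 1)) + _) ?_
      · simp only [Op.run]
        congr 1
        rw [Function.update_of_ne c.reg_ne_inp.symm, Function.update_self,
          Function.update_comm c.reg_ne_inp, Function.update_idem]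
        rfl
      · simp only [Op.run]
        rw [Function.update_of_ne c.reg_ne_inp.symm, Function.update_self]
      · nlinarith
  have h := h x 0
  rw [← hS, Function.update_eq_self, Nat.zero_div, mul_zero, zero_add] at h
  refine ((Runs.op _ _).seq ((h.congr' ?_).seq (Runs.op _ _))).mono (by omega)
  simp only [Op.run]
  congr 1
  exact (Function.update_eq_self _ _).symm

end ReductionProgram

/-! ### The program of the reduction and the edges it writes. -/

namespace ReductionProgram

open StackProgram Computability ClauseGadget

variable (q p s : ℕ) {b : ℕ} (D : (Fin p → Fin q) → Fin b → Bool)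

/-- The edges between the cells of the `i`-th literals and the group of the current literal. -/
noncomputable def literalTemplates (i : ℕ) : List (Template b) :=
  (table q p s).zipIdx.flatMap fun x => match x.1.slot with
    | none => []
    | some (j, r, w) => if j = i then
        [⟨fun y => D w y.1 != y.2, (some .base, x.2 + 1), (some .grp, q + r)⟩] else []

/-- The edges at the cells of the `i`-th literals of clauses which do not have that many literals. -/
noncomputable def padTemplates (b i : ℕ) : List (Template b) :=
  (table q p s).zipIdx.flatMap fun x => match x.1.slot with
    | none => []
    | some (j, r, w) => if j = i then
        [⟨fun _ => true, (some .base, x.2 + 1), (none, w r)⟩] else []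

/-- The edges of the path of a clause, and those to the palette which do not depend on the clause. -/
noncomputable def skeletonTemplates (b : ℕ) : List (Template b) :=
  (table q p s).zipIdx.flatMap fun x =>
    ⟨fun _ => true, (some .base, x.2), (some .base, x.2 + 1)⟩ ::
      x.1.pal.map fun c => ⟨fun _ => true, (some .base, x.2 + 1), (none, c)⟩

/-- The edges of the palette, and those at the first vertex of the path. -/
def headerTemplates (b : ℕ) : List (Template b) :=
  ((List.range q).flatMap fun c => (List.range c).map fun c' =>
    ⟨fun _ => true, (none, c'), (none, c)⟩) ++
  (others q [0]).map fun c => ⟨fun _ => true, (some .base, 0), (none, c)⟩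

/-- Read a literal, which is the `i`-th one of its clause, and write its edges. -/
noncomputable def literalProg [NeZero b] (i : ℕ) : Prog Reg Γ' (Var b) :=
  .seq dropInp <|
  .seq (.op (.pop Reg.inp fun v a => (v.1, v.2.1, decide (a = some (Γ'.bit true))))) <|
  .seq (readUnary .grp p) <|
  .seq (emitEdges (literalTemplates q p s D i)) <|
  .seq (clear Reg.grp) reset

/-- Process the `i`-th literal of a clause, if there is one. -/
noncomputable def slotProg [NeZero b] (i : ℕ) : Prog Reg Γ' (Var b) :=
  .seq peekInp <| .ite (fun v => decide (v.1 = some Γ'.comma)) (literalProg q p s D i) <|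
    .seq reset (emitEdges (padTemplates q p s b i))

/-- Process the first literals of a clause. -/
noncomputable def slotsProg [NeZero b] : ℕ → Prog Reg Γ' (Var b)
  | 0 => skip
  | i + 1 => .seq (slotsProg i) (slotProg q p s D i)

/-- Process a clause. -/
noncomputable def clauseProg [NeZero b] : Prog Reg Γ' (Var b) :=
  .seq clearSym <| .seq (slotsProg q p s D s) <| .seq dropInp <|
  .seq (emitEdges (skeletonTemplates q p s b)) <|
  pushN Reg.base (Γ'.bit false) (table q p s).length

/-- Read the number of variables, create the modulator, and write the edges of the palette and of
the first vertex of the path. -/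
def headerProg [NeZero b] : Prog Reg Γ' (Var b) :=
  .seq (pushN Reg.base one (q + p)) <| .seq (readUnary .base p) <| .seq reset <|
    emitEdges (headerTemplates q b)

/-- The reduction from satisfiability to coloring. -/
noncomputable def mainProg [NeZero b] : Prog Reg Γ' (Var b) :=
  .seq (headerProg q p) <| .seq (popSym Reg.inp) <|
  .seq (.loop (fun v => decide (v.1 = some Γ'.bra))
    (.seq (clauseProg q p s D) (popSym Reg.inp))) <|
  .seq (pushN Reg.base (Γ'.bit false) 1) <| .seq (flush Reg.base) reset

/-- The stacks with the given contents. -/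
def regs (i B g : List Γ') : Reg → List Γ'
  | .inp => i
  | .base => B
  | .tmp => []
  | .grp => g

@[simp]
theorem update_regs_inp (i B g x : List Γ') :
    Function.update (regs i B g) Reg.inp x = regs x B g := by
  funext k; cases k <;> rfl

@[simp]
theorem update_regs_base (i B g x : List Γ') :
    Function.update (regs i B g) Reg.base x = regs i x g := by
  funext k; cases k <;> rfl

@[simp]
theorem update_regs_grp (i B g x : List Γ') :
    Function.update (regs i B g) Reg.grp x = regs i B x := by
  funext k; cases k <;> rfl

theorem bounded_regs {i B g : List Γ'} {W : ℕ} (hB : B.length ≤ W) (hg : g.length ≤ W) :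
    Bounded (regs i B g) W :=
  ⟨rfl, fun c => by cases c <;> assumption⟩

/-- The edges at the cells of the `i`-th literal of the clause `C`, if the path of the clause starts
after the vertex `m`. -/
def SlotRel (C : List (Literal b)) (m i : ℕ) (x : ℕ × ℕ) : Prop :=
  ∃ o e, (table q p s)[o]? = some e ∧ ∃ r w, e.slot = some (i, r, w) ∧
    x.1 = m + (o + 1) ∧ x.2 ∈ extra q p D C e.slot

/-- The edges at the vertices of a part of the path, with the lists `Ns` of neighbors in the
modulator, which starts after the vertex `m`. -/
def BlockRel (Ns : List (List ℕ)) (m : ℕ) (x : ℕ × ℕ) : Prop :=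
  (∃ o < Ns.length, x.1 = m + o ∧ x.2 = m + (o + 1)) ∨
    ∃ o N, Ns[o]? = some N ∧ x.1 = m + (o + 1) ∧ x.2 ∈ N

variable {q p s D}

/-- Once the literal is read, the variable holds its place in the block and its sign, so the guards
select the colorings `w` that falsify it. The group counter holds `p` times the index of the group,
so adding `q + r` gives the modulator vertex of the digit `r`. -/
theorem mem_literalTemplates_edge {C : List (Literal b)} {i : ℕ} {l : Literal b}
    (hl : C[i]? = some l) (S : Reg → List Γ') (hS : (S Reg.grp).length = p * l.1) (x : ℕ × ℕ) :
    x ∈ ((literalTemplates q p s D i).filter (·.guard l.2)).map (·.edge S) ↔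
      SlotRel q p s D C (S Reg.base).length i x := by
  simp only [List.mem_map, List.mem_filter, literalTemplates, List.mem_flatMap, Prod.exists,
    List.mem_zipIdx_iff_getElem?, SlotRel]
  constructor
  · rintro ⟨t, ⟨⟨e, o, he, ht⟩, hg⟩, rfl⟩
    rcases hs : e.slot with _ | ⟨j, r, w⟩
    · simp [hs] at ht
    · simp only [hs] at ht
      split at ht
      · rename_i hj
        subst hj
        rw [List.mem_singleton] at ht
        subst ht
        simp only [bne_iff_ne, ne_eq] at hg
        refine ⟨o, e, he, r, w, hs, rfl, ?_⟩
        rw [hs]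
        simp only [extra, hl, hg, if_false, List.mem_singleton, Template.edge, Num.val,
          Counter.reg, hS]
        omega
      · simp at ht
  · rintro ⟨o, e, he, r, w, hs, hx₁, hx₂⟩
    rw [hs] at hx₂
    simp only [extra, hl] at hx₂
    split at hx₂
    · simp at hx₂
    · rename_i hD
      rw [List.mem_singleton] at hx₂
      refine ⟨⟨fun y => D w y.1 != y.2, (some .base, o + 1), (some .grp, q + r)⟩,
        ⟨⟨e, o, he, by simp [hs]⟩, by simpa using hD⟩, ?_⟩
      ext
      · exact hx₁.symm
      · simp only [Template.edge, Num.val, Counter.reg, hS, hx₂]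
        omega

theorem mem_padTemplates_edge {C : List (Literal b)} {i : ℕ} (hl : C[i]? = none)
    (S : Reg → List Γ') (y : Fin b × Bool) (x : ℕ × ℕ) :
    x ∈ ((padTemplates q p s b i).filter (·.guard y)).map (·.edge S) ↔
      SlotRel q p s D C (S Reg.base).length i x := by
  simp only [List.mem_map, List.mem_filter, padTemplates, List.mem_flatMap, Prod.exists,
    List.mem_zipIdx_iff_getElem?, SlotRel]
  constructor
  · rintro ⟨t, ⟨⟨e, o, he, ht⟩, hg⟩, rfl⟩
    rcases hs : e.slot with _ | ⟨j, r, w⟩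
    · simp [hs] at ht
    · simp only [hs] at ht
      split at ht
      · rename_i hj
        subst hj
        rw [List.mem_singleton] at ht
        subst ht
        refine ⟨o, e, he, r, w, hs, rfl, ?_⟩
        simp [hs, extra, hl, Template.edge, Num.val]
      · simp at ht
  · rintro ⟨o, e, he, r, w, hs, hx₁, hx₂⟩
    rw [hs] at hx₂
    simp only [extra, hl, List.mem_singleton] at hx₂
    refine ⟨⟨fun _ => true, (some .base, o + 1), (none, w r)⟩, ⟨⟨e, o, he, by simp [hs]⟩, rfl⟩, ?_⟩
    ext
    · exact hx₁.symm
    · exact hx₂.symm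

theorem mem_skeletonTemplates_edge (S : Reg → List Γ') (y : Fin b × Bool) (x : ℕ × ℕ) :
    x ∈ ((skeletonTemplates q p s b).filter (·.guard y)).map (·.edge S) ↔
      ∃ o e, (table q p s)[o]? = some e ∧
        ((x.1 = (S Reg.base).length + o ∧ x.2 = (S Reg.base).length + (o + 1)) ∨
          (x.1 = (S Reg.base).length + (o + 1) ∧ x.2 ∈ e.pal)) := by
  simp only [List.mem_map, List.mem_filter, skeletonTemplates, List.mem_flatMap, Prod.exists,
    List.mem_zipIdx_iff_getElem?, List.mem_cons]
  constructor
  · rintro ⟨t, ⟨⟨e, o, he, rfl | ⟨c, hc, rfl⟩⟩, -⟩, rfl⟩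
    · exact ⟨o, e, he, Or.inl ⟨rfl, rfl⟩⟩
    · exact ⟨o, e, he, Or.inr ⟨rfl, hc⟩⟩
  · rintro ⟨o, e, he, ⟨h₁, h₂⟩ | ⟨h₁, h₂⟩⟩
    · exact ⟨_, ⟨⟨e, o, he, Or.inl rfl⟩, rfl⟩, Prod.ext h₁.symm h₂.symm⟩
    · exact ⟨_, ⟨⟨e, o, he, Or.inr ⟨_, h₂, rfl⟩⟩, rfl⟩, Prod.ext h₁.symm rfl⟩

theorem mem_headerTemplates_edge (S : Reg → List Γ') (y : Fin b × Bool) (x : ℕ × ℕ) :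
    x ∈ ((headerTemplates q b).filter (·.guard y)).map (·.edge S) ↔
      (x.1 < x.2 ∧ x.2 < q) ∨ (x.1 = (S Reg.base).length ∧ x.2 ∈ others q [0]) := by
  simp only [List.mem_map, List.mem_filter, headerTemplates, List.mem_flatMap, List.mem_append,
    List.mem_range]
  constructor
  · rintro ⟨t, ⟨⟨c, hc, c', hc', rfl⟩ | ⟨c, hc, rfl⟩, -⟩, rfl⟩
    · exact Or.inl ⟨hc', hc⟩
    · exact Or.inr ⟨rfl, hc⟩
  · rintro (⟨h₁, h₂⟩ | ⟨h₁, h₂⟩)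
    · exact ⟨_, ⟨Or.inl ⟨x.2, h₂, x.1, h₁, rfl⟩, rfl⟩, rfl⟩
    · exact ⟨_, ⟨Or.inr ⟨x.2, h₂, rfl⟩, rfl⟩, Prod.ext h₁.symm rfl⟩

theorem slot_lt {e : Entry q p} (he : e ∈ table q p s) {i : ℕ} {r : Fin p} {w : Fin p → Fin q}
    (h : e.slot = some (i, r, w)) : i < s := by
  simp only [table, segmentEntries, cell, List.mem_flatMap, List.mem_append, List.mem_cons,
    List.not_mem_nil, or_false] at he
  obtain ⟨χ, _, ⟨y, _, rfl | rfl | rfl | rfl⟩ | rfl⟩ := he <;> simp at h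
  rw [← h.1]
  exact y.1.2

/-- This separates the edges common to all clauses, written by `skeletonTemplates`, from those that
depend on the literals, written slot by slot. -/
theorem blockRel_clauseLists_iff (C : List (Literal b)) (m : ℕ) (x : ℕ × ℕ) :
    BlockRel (clauseLists q p s D C) m x ↔
      (∃ o e, (table q p s)[o]? = some e ∧ ((x.1 = m + o ∧ x.2 = m + (o + 1)) ∨
        (x.1 = m + (o + 1) ∧ x.2 ∈ e.pal))) ∨ ∃ i < s, SlotRel q p s D C m i x := by
  simp only [BlockRel, clauseLists, List.length_map, List.getElem?_map, Option.map_eq_some_iff,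
    SlotRel]
  constructor
  · rintro (⟨o, ho, h⟩ | ⟨o, _, ⟨e, he, rfl⟩, h, h'⟩)
    · exact Or.inl ⟨o, _, List.getElem?_eq_getElem ho, Or.inl h⟩
    · rcases List.mem_append.1 h' with h' | h'
      · exact Or.inl ⟨o, e, he, Or.inr ⟨h, h'⟩⟩
      · rcases hs : e.slot with _ | ⟨i, r, w⟩
        · simp [hs, extra] at h'
        · exact Or.inr ⟨i, slot_lt (List.mem_of_getElem? he) hs, o, e, he, r, w, hs, h, h'⟩
  · rintro (⟨o, e, he, h | ⟨h, h'⟩⟩ | ⟨i, _, o, e, he, r, w, hs, h, h'⟩)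
    · exact Or.inl ⟨o, (List.getElem?_eq_some_iff.1 he).1, h⟩
    · exact Or.inr ⟨o, _, ⟨e, he, rfl⟩, h, List.mem_append_left _ h'⟩
    · exact Or.inr ⟨o, _, ⟨e, he, rfl⟩, h, List.mem_append_right _ h'⟩

theorem blockRel_append_iff (Ns Ns' : List (List ℕ)) (m : ℕ) (x : ℕ × ℕ) :
    BlockRel (Ns ++ Ns') m x ↔ BlockRel Ns m x ∨ BlockRel Ns' (m + Ns.length) x := by
  simp only [BlockRel]
  constructor
  · rintro (⟨o, ho, h₁, h₂⟩ | ⟨o, N, hN, h₁, h₂⟩)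
    · by_cases h : o < Ns.length
      · exact Or.inl (Or.inl ⟨o, h, h₁, h₂⟩)
      · rw [List.length_append] at ho
        exact Or.inr (Or.inl ⟨o - Ns.length, by omega, by omega, by omega⟩)
    · by_cases h : o < Ns.length
      · rw [List.getElem?_append_left h] at hN
        exact Or.inl (Or.inr ⟨o, N, hN, h₁, h₂⟩)
      · rw [List.getElem?_append_right (by omega)] at hN
        exact Or.inr (Or.inr ⟨o - Ns.length, N, hN, by omega, h₂⟩)
  · rintro ((⟨o, ho, h₁, h₂⟩ | ⟨o, N, hN, h₁, h₂⟩) | (⟨o, ho, h₁, h₂⟩ | ⟨o, N, hN, h₁, h₂⟩))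
    · exact Or.inl ⟨o, by rw [List.length_append]; omega, h₁, h₂⟩
    · refine Or.inr ⟨o, N, ?_, h₁, h₂⟩
      rwa [List.getElem?_append_left (List.getElem?_eq_some_iff.1 hN).1]
    · exact Or.inl ⟨Ns.length + o, by rw [List.length_append]; omega, by omega, by omega⟩
    · refine Or.inr ⟨Ns.length + o, N, ?_, by omega, h₂⟩
      rwa [List.getElem?_append_right (by omega), Nat.add_sub_cancel_left]

end ReductionProgram

/-! ### Correctness and running time for literals and clauses. -/

namespace ReductionProgram

open StackProgram Computability ClauseGadget

variable {q p s b : ℕ} [NeZero b] {D : (Fin p → Fin q) → Fin b → Bool}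

theorem run_reset (v : Var b) (S : Reg → List Γ') (o : List Γ') :
    Runs reset ⟨v, S, o⟩ 1 ⟨(none, 0, false), S, o⟩ := Runs.op _ _

theorem head?_flatMap_encodeLiteral {n : ℕ} (C : List (Fin n × Bool)) (rest : List Γ') :
    (C.flatMap CNFFormula.encodeLiteral ++ Γ'.ket :: rest).head? ≠ some one := by
  cases C <;> simp [CNFFormula.encodeLiteral]

/-- The list `E` matters only up to membership, since the graph does not depend on the order or the
multiplicity of its edges. -/
theorem run_literalProg (i : ℕ) : ∃ K, ∀ {n : ℕ} (C L : List (Fin n × Bool)) (l : Fin n × Bool)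
    (_ : C[i]? = some l) (rest B o : List Γ') (W : ℕ) (_ : B.length ≤ W) (_ : n ≤ W),
    ∃ E : List (ℕ × ℕ), (∀ x, x ∈ E ↔ SlotRel q p s D (C.map (literal b)) B.length i x) ∧
      Runs (literalProg q p s D i) ⟨(some Γ'.comma, 0, false),
        regs (CNFFormula.encodeLiteral l ++ (L.flatMap CNFFormula.encodeLiteral ++ Γ'.ket :: rest))
          B [], o⟩ (K * (W + 1))
        ⟨(none, 0, false), regs (L.flatMap CNFFormula.encodeLiteral ++ Γ'.ket :: rest) B [],
          E.flatMap encodePair ++ o⟩ := by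
  obtain ⟨K, hK⟩ := run_emitEdges (literalTemplates q p s D i)
  refine ⟨K * (p + 1) + 3 * p + 20, fun {n} C L l hl rest B o W hB hn => ?_⟩
  have hl' : (C.map (literal b))[i]? = some (literal b l) := by simp [hl]
  set g := unaryWord (p * (l.1 / b)) with hg
  have hglen : g.length = p * (l.1 / b) := by simp [hg, unaryWord]
  have hle : g.length ≤ p * W := by
    rw [hglen]
    exact Nat.mul_le_mul_left _ ((Nat.div_le_self _ _).trans (l.1.2.le.trans hn))
  set R := L.flatMap CNFFormula.encodeLiteral ++ Γ'.ket :: rest with hR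
  refine ⟨_, mem_literalTemplates_edge hl' (regs R B g) hglen, ?_⟩
  have h₁ := run_readUnary (b := b) .grp p l.1 (some Γ'.comma) l.2 (regs (unaryWord l.1 ++ R) B []) R o rfl
    (head?_flatMap_encodeLiteral _ _)
  -- The group counter can reach `p * W`, hence the larger bound on the counters.
  have h₂ := hK (literal b l).2 (regs R B g) ((p + 1) * W)
    (bounded_regs (by nlinarith) (by nlinarith)) o
  refine ((Runs.op _ _).seq ((Runs.op _ _).seq ((h₁.congr' ?_).seq ((h₂.congr' ?_).seq
    ((run_clear _ _ _ _ _).seq (Runs.congr (run_reset _ _ _) ?_)))))).mono ?_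
  · simp only [Op.run, CNFFormula.encodeLiteral]
    simp [regs]
  · simp [Counter.reg, regs, literal, hg]
  · simp [literal]
  · change 1 + (1 + ((p + 6) * l.1 + 3 + (K * ((p + 1) * W + 1) + (2 * g.length + 2 + 1)))) ≤ _
    have h₃ : (p + 6) * l.1 ≤ (p + 6) * W := Nat.mul_le_mul_left _ (l.1.2.le.trans hn)
    have h₄ : K * ((p + 1) * W + 1) ≤ K * (p + 1) * (W + 1) := by
      rw [mul_assoc]
      exact Nat.mul_le_mul_left _ (by nlinarith)
    nlinarith

theorem run_slotProg (i : ℕ) : ∃ K, ∀ {n : ℕ} (C : List (Fin n × Bool)) (rest B o : List Γ')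
    (W : ℕ) (_ : B.length ≤ W) (_ : n ≤ W),
    ∃ E : List (ℕ × ℕ), (∀ x, x ∈ E ↔ SlotRel q p s D (C.map (literal b)) B.length i x) ∧
      Runs (slotProg q p s D i) ⟨(none, 0, false),
        regs ((C.drop i).flatMap CNFFormula.encodeLiteral ++ Γ'.ket :: rest) B [], o⟩ (K * (W + 1))
        ⟨(none, 0, false),
          regs ((C.drop (i + 1)).flatMap CNFFormula.encodeLiteral ++ Γ'.ket :: rest) B [],
          E.flatMap encodePair ++ o⟩ := by
  obtain ⟨K, hK⟩ := run_literalProg (q := q) (p := p) (s := s) (D := D) i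
  obtain ⟨K', hK'⟩ := run_emitEdges (padTemplates q p s b i)
  refine ⟨K + K' + 3, fun {n} C rest B o W hB hn => ?_⟩
  by_cases hi : i < C.length
  · have hl : C[i]? = some C[i] := List.getElem?_eq_getElem hi
    obtain ⟨E, hE, hrun⟩ := hK C (C.drop (i + 1)) C[i] hl rest B o W hB hn
    refine ⟨E, hE, ?_⟩
    rw [List.drop_eq_getElem_cons hi, List.flatMap_cons, List.append_assoc]
    refine ((Runs.op _ _).seq (Runs.ite_true (by simp [Op.run, regs, CNFFormula.encodeLiteral])
      (hrun.congr' ?_))).mono (by nlinarith)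
    simp [Op.run, regs, CNFFormula.encodeLiteral]
  · have hl : (C.map (literal b))[i]? = none := by simpa using hi
    refine ⟨_, mem_padTemplates_edge hl (regs (Γ'.ket :: rest) B []) (0, false), ?_⟩
    rw [List.drop_eq_nil_of_le (by omega), List.drop_eq_nil_of_le (by omega)]
    have h := hK' (0, false) (regs (Γ'.ket :: rest) B []) W (bounded_regs hB (by simp)) o
    refine ((Runs.op _ _).seq (Runs.ite_false (by simp [Op.run, regs])
      ((run_reset _ _ _).seq h))).mono (by nlinarith)

theorem run_slotsProg (j : ℕ) : ∃ K, ∀ {n : ℕ} (C : List (Fin n × Bool)) (rest B o : List Γ')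
    (W : ℕ) (_ : B.length ≤ W) (_ : n ≤ W),
    ∃ E : List (ℕ × ℕ), (∀ x, x ∈ E ↔ ∃ i < j, SlotRel q p s D (C.map (literal b)) B.length i x) ∧
      Runs (slotsProg q p s D j) ⟨(none, 0, false),
        regs (C.flatMap CNFFormula.encodeLiteral ++ Γ'.ket :: rest) B [], o⟩ (K * (W + 1))
        ⟨(none, 0, false),
          regs ((C.drop j).flatMap CNFFormula.encodeLiteral ++ Γ'.ket :: rest) B [],
          E.flatMap encodePair ++ o⟩ := by
  induction j with
  | zero =>
    refine ⟨1, fun {n} C rest B o W _ _ => ⟨[], by simp, ?_⟩⟩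
    exact (run_skip _).mono (by omega)
  | succ j ih =>
    obtain ⟨K, hK⟩ := ih
    obtain ⟨K', hK'⟩ := run_slotProg (q := q) (p := p) (s := s) (D := D) j
    refine ⟨K + K', fun {n} C rest B o W hB hn => ?_⟩
    obtain ⟨E, hE, hrun⟩ := hK C rest B o W hB hn
    obtain ⟨E', hE', hrun'⟩ := hK' C rest B (E.flatMap encodePair ++ o) W hB hn
    refine ⟨E' ++ E, fun x => ?_, ?_⟩
    · rw [List.mem_append, hE, hE', Nat.exists_lt_succ_right, or_comm]
    · rw [List.flatMap_append, List.append_assoc, add_mul]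
      exact hrun.seq hrun'

/-- The base stack grows only after all edges are written, so these share one offset. Its new length
is the index of the last vertex of this clause, which precedes the first vertex of the next one. -/
theorem run_clauseProg : ∃ K, ∀ {n : ℕ} (C : List (Fin n × Bool)) (_ : C.length ≤ s)
    (rest B o : List Γ') (W : ℕ) (_ : B.length ≤ W) (_ : n ≤ W),
    ∃ E : List (ℕ × ℕ),
      (∀ x, x ∈ E ↔ BlockRel (clauseLists q p s D (C.map (literal b))) B.length x) ∧
      Runs (clauseProg q p s D) ⟨(some Γ'.bra, 0, false),
        regs (C.flatMap CNFFormula.encodeLiteral ++ Γ'.ket :: rest) B [], o⟩ (K * (W + 1))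
        ⟨(none, 0, false),
          regs rest (List.replicate (table q p s).length (Γ'.bit false) ++ B) [],
          E.flatMap encodePair ++ o⟩ := by
  obtain ⟨K, hK⟩ := run_slotsProg (q := q) (p := p) (s := s) (D := D) s
  obtain ⟨K', hK'⟩ := run_emitEdges (skeletonTemplates q p s b)
  refine ⟨K + K' + (table q p s).length + 5, fun {n} C hC rest B o W hB hn => ?_⟩
  obtain ⟨E, hE, hrun⟩ := hK C rest B o W hB hn
  -- The width bound ensures that the `s` slots consume all literals and only the closing bracket is
  -- left.
  rw [List.drop_eq_nil_of_le hC] at hrun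
  have h := hK' (0, false) (regs rest B []) W (bounded_regs hB (by simp)) (E.flatMap encodePair ++ o)
  have hE' := mem_skeletonTemplates_edge (q := q) (p := p) (s := s) (regs rest B [])
    ((0, false) : Fin b × Bool)
  refine ⟨((skeletonTemplates q p s b).filter (·.guard (0, false))).map
    (·.edge (regs rest B [])) ++ E, fun x => ?_, ((Runs.op _ _).seq (hrun.seq ((Runs.op _ _).seq
    ((h.congr' ?_).seq ((run_pushN _ _ _ _).congr ?_))))).mono ?_⟩
  · rw [List.mem_append, hE, hE', blockRel_clauseLists_iff]
    rfl
  · simp [Op.run, regs]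
  · simp [regs]
  · nlinarith

/-- `W` bounds the base stack at the end of the loop, hence in every round, so all rounds have the
same cost bound. -/
theorem run_clauses : ∃ K, ∀ {n : ℕ} (X : List (List (Fin n × Bool))) (_ : ∀ C ∈ X, C.length ≤ s)
    (B o : List Γ') (W : ℕ) (_ : B.length + (table q p s).length * X.length ≤ W) (_ : n ≤ W),
    ∃ E : List (ℕ × ℕ),
      (∀ x, x ∈ E ↔
        BlockRel (X.flatMap fun C => clauseLists q p s D (C.map (literal b))) B.length x) ∧
      Runs (.loop (fun v => decide (v.1 = some Γ'.bra))
          (.seq (clauseProg q p s D) (popSym Reg.inp)) : Prog Reg Γ' (Var b))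
        ⟨((X.flatMap CNFFormula.encodeClause).head?, 0, false),
          regs (X.flatMap CNFFormula.encodeClause).tail B [], o⟩ (X.length * (K * (W + 1)) + 1)
        ⟨(none, 0, false),
          regs [] (List.replicate ((table q p s).length * X.length) (Γ'.bit false) ++ B) [],
          E.flatMap encodePair ++ o⟩ := by
  obtain ⟨K, hK⟩ := run_clauseProg (q := q) (p := p) (s := s) (D := D)
  refine ⟨K + 2, fun {n} X hX => ?_⟩
  induction X with
  | nil =>
    intro B o W _ _
    exact ⟨[], by simp [BlockRel], Runs.loop_false rfl |>.mono (by simp)⟩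
  | cons C X ih =>
    intro B o W hW hn
    rw [List.length_cons, mul_add, mul_one] at hW
    have hinp : (C :: X).flatMap CNFFormula.encodeClause = Γ'.bra ::
        (C.flatMap CNFFormula.encodeLiteral ++ Γ'.ket :: X.flatMap CNFFormula.encodeClause) := by
      simp [CNFFormula.encodeClause]
    obtain ⟨E, hE, hrun⟩ := hK C (hX C List.mem_cons_self) (X.flatMap CNFFormula.encodeClause) B o W
      (by omega) hn
    obtain ⟨E', hE', hrun'⟩ := ih (fun C' hC' => hX C' (List.mem_cons_of_mem _ hC'))
      (List.replicate (table q p s).length (Γ'.bit false) ++ B) (E.flatMap encodePair ++ o) W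
      (by simp only [List.length_append, List.length_replicate]; omega) hn
    refine ⟨E' ++ E, fun x => ?_, ?_⟩
    · rw [List.mem_append, hE, hE', List.flatMap_cons, blockRel_append_iff, or_comm]
      simp [clauseLists, add_comm]
    · rw [hinp]
      refine ((Runs.loop_true rfl (hrun.seq (Runs.op _ _)) (hrun'.congr' ?_)).congr ?_).mono ?_
      · simp [Op.run, regs]
      · simp [mul_add, ← List.append_assoc, List.replicate_append_replicate]
      · simp only [List.length_cons]
        nlinarith

end ReductionProgram

/-! ### Instances given by lists of pairs. -/

namespace GraphWithModulator

/-- The graph on `0, …, n - 1` with the given edges and the modulator `0, …, m - 1`. -/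
def ofPairs (n m : ℕ) (E : List (ℕ × ℕ)) (hE : ∀ x ∈ E, x.1 < n ∧ x.2 < n ∧ x.1 ≠ x.2) :
    GraphWithModulator where
  numVertices := n
  edges := E.attach.map fun x => (⟨x.1.1, (hE x.1 x.2).1⟩, ⟨x.1.2, (hE x.1 x.2).2.1⟩)
  loopless := by
    simp only [List.mem_map, List.mem_attach, true_and, forall_exists_index]
    rintro _ x rfl h
    exact (hE x.1 x.2).2.2 (congrArg Fin.val h)
  modulator := Finset.univ.filter fun v => v.1 < m

variable {n m : ℕ} {E : List (ℕ × ℕ)} (hE : ∀ x ∈ E, x.1 < n ∧ x.2 < n ∧ x.1 ≠ x.2)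

theorem mem_edges_ofPairs (u v : Fin n) : (u, v) ∈ (ofPairs n m E hE).edges ↔ (u.1, v.1) ∈ E := by
  refine List.mem_map.trans ⟨?_, fun h => ⟨⟨_, h⟩, List.mem_attach _ _, rfl⟩⟩
  rintro ⟨x, _, h⟩
  obtain ⟨rfl, rfl⟩ := Prod.mk.inj h
  exact x.2

theorem mem_modulator_ofPairs (v : Fin (ofPairs n m E hE).numVertices) :
    v ∈ (ofPairs n m E hE).modulator ↔ v.1 < m :=
  Finset.mem_filter.trans (and_iff_right (Finset.mem_univ _))

theorem card_modulator_ofPairs (hm : m ≤ n) : (ofPairs n m E hE).modulator.card = m := by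
  simp [ofPairs, Fin.card_filter_val_lt, hm]

/-- The modulator is an initial segment, so the vertex word consists of ones followed by zeros. This
is the base stack read from the bottom: it serves both as the counter of the vertices and as their
code. -/
theorem encode_ofPairs (hm : m ≤ n) : (ofPairs n m E hE).encode =
    unaryWord m ++ List.replicate (n - m) (Computability.Γ'.bit false) ++
      E.flatMap ReductionProgram.encodePair := by
  have h₁ : (ofPairs n m E hE).edges.flatMap encodeEdge =
      E.flatMap ReductionProgram.encodePair := by
    simp only [ofPairs, List.flatMap_map]
    conv_rhs => rw [← List.attach_map_subtype_val E, List.flatMap_map]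
    rfl
  rw [encode, h₁]
  congr 1
  refine List.ext_getElem (by simp [ofPairs, unaryWord, hm]) fun i hi _ => ?_
  simp only [List.getElem_ofFn, List.getElem_append, unaryWord, List.length_replicate,
    List.getElem_replicate, mem_modulator_ofPairs]
  split <;> simp_all

end GraphWithModulator

/-! ### The complete reduction. -/

namespace ReductionProgram

open StackProgram Computability ClauseGadget

variable {q p s b : ℕ} [NeZero b] {D : (Fin p → Fin q) → Fin b → Bool}

/-- The initial `q + p` symbols stand for the palette and one group more than the `n / b` groups
counted while the number of variables is read. -/
theorem run_headerProg : ∃ K, ∀ (n : ℕ) (rest : List Γ') (_ : rest.head? ≠ some one) (W : ℕ)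
    (_ : modulatorSize q p b n ≤ W) (_ : n ≤ W),
    ∃ E : List (ℕ × ℕ), (∀ x, x ∈ E ↔ (x.1 < x.2 ∧ x.2 < q) ∨
        (x.1 = modulatorSize q p b n ∧ x.2 ∈ others q [0])) ∧
      Runs (headerProg q p) ⟨((none, 0, false) : Var b), regs (unaryWord n ++ rest) [] [], []⟩
        (K * (W + 1))
        ⟨(none, 0, false), regs rest (unaryWord (modulatorSize q p b n)) [],
          E.flatMap encodePair⟩ := by
  obtain ⟨K, hK⟩ := run_emitEdges (headerTemplates q b)
  refine ⟨K + q + 2 * p + 20, fun n rest hrest W hW hn => ?_⟩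
  have hlen : ∀ k, (unaryWord k).length = k := fun k => List.length_replicate
  have hE := mem_headerTemplates_edge (q := q) (regs rest (unaryWord (modulatorSize q p b n)) [])
    ((0, false) : Fin b × Bool)
  have h₁ := run_readUnary (b := b) .base p n none false
    (regs (unaryWord n ++ rest) (unaryWord (q + p)) []) rest [] rfl hrest
  have h₂ := hK (0, false) (regs rest (unaryWord (modulatorSize q p b n)) []) W
    (bounded_regs (by rwa [hlen]) (by simp)) []
  refine ⟨_, fun x => (hE x).trans (by simp only [regs, hlen]), ((run_pushN _ _ _ _).seq
    ((h₁.congr' ?_).seq ((run_reset _ _ _).seq ((h₂.congr' ?_).congr ?_)))).mono ?_⟩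
  · simp [regs, unaryWord]
  · simp only [Counter.reg, regs, update_regs_inp, update_regs_base, unaryWord_append,
      modulatorSize]
    congr 3
    ring
  · simp
  · nlinarith

/-- `PathRel` also joins the last vertex to a nonexistent successor, which the two bounds exclude.
The vertex `m` carries the list `N`, and the block `Ns` starts after it. -/
theorem pathRel_iff {m : ℕ} {N : List ℕ} {Ns : List (List ℕ)} (hq : q ≤ m)
    (hlt : ∀ N' ∈ N :: Ns, ∀ x ∈ N', x < m) (x : ℕ × ℕ) :
    (GraphWithModulator.PathRel q m (N :: Ns) x.1 x.2 ∧ x.1 < m + (Ns.length + 1) ∧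
      x.2 < m + (Ns.length + 1)) ↔
      ((x.1 < x.2 ∧ x.2 < q) ∨ (x.1 = m ∧ x.2 ∈ N)) ∨ BlockRel Ns m x := by
  rw [GraphWithModulator.PathRel, BlockRel]
  constructor
  · rintro ⟨h | ⟨h₁, h₂⟩ | ⟨N', h₁, h₂, h₃⟩, h₄, h₅⟩
    · exact Or.inl (Or.inl h)
    · exact Or.inr (Or.inl ⟨x.1 - m, by omega, by omega, by omega⟩)
    · obtain ⟨j, hj⟩ := Nat.exists_eq_add_of_le h₁
      rw [hj, Nat.add_sub_cancel_left] at h₂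
      cases j with
      | zero =>
        obtain rfl : N = N' := by simpa using h₂
        exact Or.inl (Or.inr ⟨hj, h₃⟩)
      | succ j => exact Or.inr (Or.inr ⟨j, N', by simpa using h₂, hj, h₃⟩)
  · rintro ((⟨h₁, h₂⟩ | ⟨h₁, h₂⟩) | ⟨o, ho, h₁, h₂⟩ | ⟨o, N', hN, h₁, h₂⟩)
    · exact ⟨Or.inl ⟨h₁, h₂⟩, by omega, by omega⟩
    · have := hlt N List.mem_cons_self _ h₂
      exact ⟨Or.inr (Or.inr ⟨N, h₁.ge, by simp [h₁], h₂⟩), by omega, by omega⟩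
    · exact ⟨Or.inr (Or.inl ⟨by omega, by omega⟩), by omega, by omega⟩
    · have := hlt N' (List.mem_cons_of_mem _ (List.mem_of_getElem? hN)) _ h₂
      have ho := (List.getElem?_eq_some_iff.1 hN).1
      exact ⟨Or.inr (Or.inr ⟨N', by omega, by simpa [h₁] using hN, h₂⟩), by omega, by omega⟩

theorem length_formulaLists (φ : CNFFormula) :
    (formulaLists q p s D φ).length = (table q p s).length * φ.clauses.length := by
  simp [formulaLists, clauseLists, List.length_flatMap, mul_comm]

theorem run_mainProg : ∃ R : Polynomial ℕ, ∀ φ : CNFFormula, φ.HasWidthAtMost s →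
    ∃ E : List (ℕ × ℕ),
      (∀ x, x ∈ E ↔ GraphWithModulator.PathRel q (modulatorSize q p b φ.numVars)
          (others q [0] :: formulaLists q p s D φ) x.1 x.2 ∧
        x.1 < modulatorSize q p b φ.numVars + ((formulaLists q p s D φ).length + 1) ∧
        x.2 < modulatorSize q p b φ.numVars + ((formulaLists q p s D φ).length + 1)) ∧
      Runs (mainProg q p s D)
        ⟨(none, 0, false), Function.update (fun _ => []) Reg.inp φ.encode, []⟩
        (R.eval φ.encode.length)
        ⟨(none, 0, false), fun _ => [], unaryWord (modulatorSize q p b φ.numVars) ++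
          List.replicate ((formulaLists q p s D φ).length + 1) (Γ'.bit false) ++
          E.flatMap encodePair⟩ := by
  obtain ⟨K, hK⟩ := run_headerProg (q := q) (p := p) (b := b)
  obtain ⟨K', hK'⟩ := run_clauses (q := q) (p := p) (s := s) (D := D)
  set T := (table q p s).length with hT
  -- The second factor is `W + 1`, where `W` bounds the counters: the modulator has at most `q + p *
  -- (N + 1)` vertices, and each of the at most `N` clauses adds `T`. The first factor pays for the
  -- header, for the clauses at `K' * (W + 1)` each, and for the final flush.
  refine ⟨(Polynomial.C (K + 12) + Polynomial.C K' * Polynomial.X) *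
    (Polynomial.C (q + p + T + 1) * (Polynomial.X + 1) + 1), fun φ hφ => ?_⟩
  set m := modulatorSize q p b φ.numVars with hm
  set N := φ.encode.length with hN
  set W := (q + p + T + 1) * (N + 1) with hW
  have hclauses : ∀ X : List (List (Fin φ.numVars × Bool)),
      X.length ≤ (X.flatMap CNFFormula.encodeClause).length := by
    intro X
    induction X with
    | nil => simp
    | cons C X ih =>
      rw [List.flatMap_cons, List.length_append, List.length_cons, CNFFormula.encodeClause,
        List.length_cons]
      omega
  have hNle : φ.numVars + φ.clauses.length ≤ N := by
    rw [hN, CNFFormula.encode, List.length_append]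
    exact add_le_add (by simp [unaryWord]) (hclauses _)
  have hmW : m + T * φ.clauses.length ≤ W := by
    have h₁ : p * (φ.numVars / b + 1) ≤ p * (N + 1) :=
      Nat.mul_le_mul_left _ (by have := Nat.div_le_self φ.numVars b; omega)
    have h₂ : T * φ.clauses.length ≤ T * (N + 1) := Nat.mul_le_mul_left _ (by omega)
    rw [hm, hW, modulatorSize]
    nlinarith
  have hnW : φ.numVars ≤ W := by rw [hW]; nlinarith
  have hrest : (φ.clauses.flatMap CNFFormula.encodeClause).head? ≠ some one := by
    rcases φ.clauses with _ | ⟨C, X⟩ <;> simp [CNFFormula.encodeClause]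
  obtain ⟨E, hE, hrun⟩ := hK φ.numVars _ hrest W (by omega) hnW
  have hlen : ∀ k, (unaryWord k).length = k := fun k => List.length_replicate
  obtain ⟨E', hE', hrun'⟩ := hK' φ.clauses hφ (unaryWord m) (E.flatMap encodePair) W
    (by rw [hlen]; exact hmW) hnW
  refine ⟨E' ++ E, fun x => ?_, ?_⟩
  · rw [pathRel_iff (m := m) (Nat.le_add_right _ _) fun N hN x hx => lt_of_mem_formulaLists φ hN hx,
      List.mem_append, hE, hE', or_comm, hlen]
    rfl
  · refine (((hrun.congr' ?_).seq ((Runs.op _ _).seq ((hrun'.congr' ?_).seq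
      ((run_pushN _ _ _ _).seq ((run_flush _ _ _ _ _).seq
        ((run_reset _ _ _).congr ?_)))))).mono ?_)
    · congr 1
      funext k
      cases k <;> simp [regs, CNFFormula.encode]
    · simp [Op.run, regs, hm]
    · rw [length_formulaLists]
      congr 1
      · funext k
        cases k <;> simp [regs]
      · simp [regs, unaryWord, ← hT, List.replicate_succ']
    · simp only [Polynomial.eval_mul, Polynomial.eval_add, Polynomial.eval_C, Polynomial.eval_X,
        Polynomial.eval_one, regs, update_regs_base, List.length_append, List.length_replicate,
        hlen]
      have h₁ : φ.clauses.length * (K' * (W + 1)) ≤ K' * N * (W + 1) := by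
        rw [mul_assoc, mul_left_comm K' N]
        exact Nat.mul_le_mul_right (K' * (W + 1)) (by omega)
      have h₂ : (K + 12 + K' * N) * (W + 1) = K * (W + 1) + 12 * (W + 1) + K' * N * (W + 1) := by
        ring
      rw [h₂]
      omega

/-- An algorithm for coloring yields an algorithm for satisfiability. -/
theorem satSolvable_of_coloringSolvable {c d : ℝ} (hq : 3 ≤ q) (hp : 0 < p)
    (hD : Function.Surjective D) (A : ℕ) (hd : 1 ≤ d)
    (hA : ∀ n : ℕ, c ^ modulatorSize q p b n ≤ A * d ^ n)
    (h : ColoringOnPathPlusKVSolvableInOStarPow q c) : SATSolvableInOStarPow s d := by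
  obtain ⟨R, hR⟩ := run_mainProg (q := q) (p := p) (s := s) (D := D)
  have key : ∀ φ : CNFFormula, ∃ I : GraphWithModulator, φ.HasWidthAtMost s →
      IsPathGraph I.remainder ∧ (I.graph.Colorable q ↔ φ.Satisfiable) ∧
      I.modulator.card = modulatorSize q p b φ.numVars ∧
      Runs (mainProg q p s D)
        ⟨(none, 0, false), Function.update (fun _ => []) Reg.inp φ.encode, []⟩
        (R.eval φ.encode.length) ⟨(none, 0, false), fun _ => [], I.encode⟩ := by
    intro φ
    by_cases hφ : φ.HasWidthAtMost s
    swap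
    -- Formulas of larger width get a dummy instance, so that `f` is total.
    · exact ⟨.ofPairs 0 0 [] (by simp), fun h => absurd h hφ⟩
    obtain ⟨E, hE, hrun⟩ := hR φ hφ
    have hlt := fun N hN x hx => lt_of_mem_formulaLists (s := s) (D := D) φ (N := N) hN (x := x) hx
    have hqm : q ≤ modulatorSize q p b φ.numVars := Nat.le_add_right _ _
    have hne : ∀ x ∈ E,
        x.1 < modulatorSize q p b φ.numVars + ((formulaLists q p s D φ).length + 1) ∧
        x.2 < modulatorSize q p b φ.numVars + ((formulaLists q p s D φ).length + 1) ∧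
        x.1 ≠ x.2 := by
      intro x hx
      obtain ⟨h₁, h₂, h₃⟩ := (hE x).1 hx
      refine ⟨h₂, h₃, ?_⟩
      rcases h₁ with h₁ | h₁ | ⟨N, h₁, hN, h₄⟩
      · omega
      · omega
      · have := hlt N (List.mem_of_getElem? hN) _ h₄
        omega
    have hedges : ∀ u v, (u, v) ∈ (GraphWithModulator.ofPairs _
        (modulatorSize q p b φ.numVars) E hne).edges ↔
        GraphWithModulator.PathRel q (modulatorSize q p b φ.numVars)
          (others q [0] :: formulaLists q p s D φ) u.1 v.1 := fun u v =>
      (GraphWithModulator.mem_edges_ofPairs hne u v).trans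
        ((hE _).trans (and_iff_left ⟨u.2, v.2⟩))
    refine ⟨.ofPairs _ (modulatorSize q p b φ.numVars) E hne, fun _ => ⟨?_, ?_, ?_, ?_⟩⟩
    · exact GraphWithModulator.isPathGraph_remainder rfl
        (GraphWithModulator.mem_modulator_ofPairs hne) hedges hqm (by simp) hlt
    · rw [satisfiable_iff (s := s) (D := D) hq hp hD φ hφ]
      exact GraphWithModulator.colorable_iff rfl hedges hqm hlt (by omega)
    · exact GraphWithModulator.card_modulator_ofPairs hne (Nat.le_add_right _ _)
    · rw [GraphWithModulator.encode_ofPairs hne (Nat.le_add_right _ _), Nat.add_sub_cancel_left]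
      exact hrun
  choose f hf using key
  have hlen : ∀ φ : CNFFormula, φ.HasWidthAtMost s →
      (f φ).encode.length ≤ R.eval φ.encode.length := by
    intro φ hφ
    obtain ⟨t, ht, hexec⟩ := (hf φ hφ).2.2.2
    -- Each step writes at most one symbol, so the time bound also bounds the length of the
    -- instance.
    exact hexec.out_length_le.trans (by simpa using ht)
  refine solvableInOStarPow_of_reduction (mainProg q p s D) Reg.inp (none, 0, false) f R A
    (fun φ hφ => (hf φ hφ).1) (fun φ hφ => (hf φ hφ).2.1) (fun φ hφ => (hf φ hφ).2.2.2) hlen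
    (fun φ hφ => ?_) hd h
  rw [(hf φ hφ).2.2.1]
  exact hA φ.numVars

end ReductionProgram

/-! ### Choice of the constants and conclusion. -/

/-- There are instances of coloring whose parameter is one, so that the base of the running time has
to be positive. -/
theorem pos_of_coloringSolvable {q : ℕ} {c : ℝ}
    (h : ColoringOnPathPlusKVSolvableInOStarPow q c) : 0 < c := by
  by_contra hc
  obtain ⟨M, p, hM⟩ := h
  have hE : ∀ x ∈ ([] : List (ℕ × ℕ)), x.1 < 2 ∧ x.2 < 2 ∧ x.1 ≠ x.2 := by simp
  -- Two isolated vertices, one of them in the modulator; the remainder is a path with a single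
  -- vertex.
  obtain ⟨t, r, ht, _, ⟨⟨n, hn⟩, hle⟩⟩ := hM (.ofPairs 2 1 [] hE)
    (GraphWithModulator.isPathGraph_remainder (q := 0) (m := 1) (spec := [[]]) rfl
      (GraphWithModulator.mem_modulator_ofPairs hE)
      (fun u v => (GraphWithModulator.mem_edges_ofPairs hE u v).trans (by
        have hu : u.1 < 2 := u.2
        have hv : v.1 < 2 := v.2
        simp only [GraphWithModulator.PathRel, List.not_mem_nil, false_iff, not_or, not_exists]
        refine ⟨by omega, by omega, fun N hN => ?_⟩
        obtain rfl : N = [] := by simpa using List.mem_of_getElem? hN.2.1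
        simp at hN))
      (by simp) (by simp) (by simp))
  beta_reduce at ht
  rw [GraphWithModulator.card_modulator_ofPairs hE (by simp), pow_one] at ht
  have ht' : (t : ℝ) ≤ 0 :=
    ht.trans (mul_nonpos_of_nonpos_of_nonneg (not_lt.1 hc) (Nat.cast_nonneg _))
  have ht'' : t = 0 := by exact_mod_cast le_antisymm ht' (Nat.cast_nonneg _)
  obtain rfl : n = 0 := Nat.le_zero.1 (hle.trans ht''.le)
  -- Zero steps would make the initial configuration a halted one, although it still carries the
  -- label `main`.
  have := congrArg (Option.map Turing.TM2.Cfg.l) hn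
  exact Option.some_ne_none M.tm.main (Option.some.inj this)

/-- Choose `p` with `(c / q) ^ p < 1 / 2` and `b` as the rounded-down binary logarithm of `q ^ p`.
Rounding loses less than a factor of two, so `2 ^ b > q ^ p / 2 > c ^ p`. -/
theorem exists_group_sizes {q : ℕ} {c : ℝ} (hc : 1 ≤ c) (hcq : c < q) :
    ∃ p b : ℕ, 0 < p ∧ 0 < b ∧ 2 ^ b ≤ q ^ p ∧ c ^ p < 2 ^ b := by
  have hq : (0 : ℝ) < q := by linarith
  obtain ⟨p, hp⟩ := exists_pow_lt_of_lt_one (by norm_num : (0 : ℝ) < 1 / 2)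
    ((div_lt_one hq).2 hcq)
  have hlt : c ^ p < 2 ^ Nat.log 2 (q ^ p) := by
    have h₁ : ((q ^ p : ℕ) : ℝ) < ((2 ^ (Nat.log 2 (q ^ p) + 1) : ℕ) : ℝ) :=
      Nat.cast_lt.2 (Nat.lt_pow_succ_log_self (by norm_num) _)
    push_cast at h₁
    rw [div_pow, div_lt_iff₀ (by positivity)] at hp
    rw [pow_succ] at h₁
    linarith
  refine ⟨p, Nat.log 2 (q ^ p), Nat.pos_of_ne_zero ?_, Nat.pos_of_ne_zero ?_,
    Nat.pow_log_le_self 2 (pow_ne_zero p (by exact_mod_cast hq.ne')), hlt⟩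
  · rintro rfl
    norm_num at hp
  · intro h
    rw [h, pow_zero] at hlt
    exact absurd (one_le_pow₀ hc) (not_le.2 hlt)

theorem exists_surjective_of_pow_le {q p b : ℕ} (h : 2 ^ b ≤ q ^ p) :
    ∃ D : (Fin p → Fin q) → Fin b → Bool, Function.Surjective D := by
  obtain ⟨f⟩ := Function.Embedding.nonempty_of_card_le
    (α := Fin b → Bool) (β := Fin p → Fin q) (by simpa using h)
  exact ⟨Function.invFun f, Function.invFun_surjective f.injective⟩

theorem mainTheorem6 (hSETH : SETH) (ε : ℝ) (hε : 0 < ε) (q : ℕ) (hq : 3 ≤ q) :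
    ¬ ColoringOnPathPlusKVSolvableInOStarPow q ((q : ℝ) - ε) := by
  intro h
  -- For large `ε` the base `q - ε` is negative and its even powers may be huge; positivity is
  -- needed to compare its powers with those of `c`.
  have hpos := pos_of_coloringSolvable h
  have hq' : (3 : ℝ) ≤ q := by exact_mod_cast hq
  set c := max ((q : ℝ) - ε) 1 with hc
  have hc1 : 1 ≤ c := le_max_right _ _
  have hcq : c < q := max_lt (by linarith) (by linarith)
  obtain ⟨p, b, hp, hb, hbp, hlt⟩ := exists_group_sizes hc1 hcq
  obtain ⟨D, hD⟩ := exists_surjective_of_pow_le hbp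
  have : NeZero b := ⟨hb.ne'⟩
  -- A block of `b` variables costs `p` modulator vertices, so the cost per variable is the `b`-th
  -- root of `c ^ p`.
  set d : ℝ := (c ^ p) ^ ((b : ℝ)⁻¹) with hd
  have hdb : d ^ b = c ^ p := Real.rpow_inv_natCast_pow (by positivity) hb.ne'
  have hd1 : 1 ≤ d := Real.one_le_rpow (one_le_pow₀ hc1) (by positivity)
  have hd2 : d < 2 := lt_of_pow_lt_pow_left₀ b (by norm_num) (hdb ▸ hlt)
  obtain ⟨s, hs⟩ := hSETH (2 - d) (by linarith)
  rw [sub_sub_cancel] at hs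
  -- The constant pays for the palette and for the one additional group; it is rounded up because a
  -- natural number is required.
  refine hs (ReductionProgram.satSolvable_of_coloringSolvable (D := D) hq hp hD ⌈c ^ (q + p)⌉₊ hd1
    (fun n => ?_) h)
  calc ((q : ℝ) - ε) ^ ClauseGadget.modulatorSize q p b n
      ≤ c ^ ClauseGadget.modulatorSize q p b n :=
        pow_le_pow_left₀ hpos.le (le_max_left _ _) _
    _ = c ^ (q + p) * d ^ (b * (n / b)) := by
        rw [pow_mul, hdb, ← pow_mul, ← pow_add, ClauseGadget.modulatorSize]
        congr 1
        ring
    _ ≤ ⌈c ^ (q + p)⌉₊ * d ^ n :=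
        mul_le_mul (Nat.le_ceil _) (pow_le_pow_right₀ hd1 (Nat.mul_div_le n b)) (by positivity)
          (Nat.cast_nonneg _)
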